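/- Let $m,l\in\mathbb R$, $F=1+m(x^2+y^2)$, and let $$M^3(m,l)=\Big(\{F\neq0\}\subset\mathbb R^3,\ h=\frac{dx^2+dy^2}{F^2}+\Big[dz+\frac l2\,\frac{y\,dx-x\,dy}{F}\Big]^2\Big)$$ be the BCV space, with the Riemannian submersion $\pi(x,y,z)=(x,y)$ onto $\big(\{F\neq 0\}\subset\mathbb R^2,\ h_1=(dx^2+dy^2)/F^2\big)$. Let $I,J\subseteq\mathbb R$ be open intervals, $\gamma=(x,y):I\to(\mathbb R^2,h_1)$ a smooth curve parametrized by arclength (with $F\ne0$ along $\gamma$), and $\varphi:\Sigma=I\times J\to M^3(m,l)$, $\varphi(s,z)=(x(s),y(s),z)$, the Hopf cylinder over $\gamma$; $J=\mathbb R$ is the full Hopf cylinder $\bigcup_{s\in I}\pi^{-1}(\gamma(s))$. Let $\kappa$ be the signed geodesic curvature of $\gamma$ in $(\mathbb R^2,h_1)$ with respect to the unit normal $y'\partial_x-x'\partial_y$, and let $H$ be the mean curvature of $\varphi$ with respect to the unit normal $\xi=\frac{y'}{F}E_1-\frac{x'}{F}E_2$, where $E_1=F\partial_x-\frac{ly}2\partial_z$,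 $E_2=F\partial_y+\frac{lx}2\partial_z$. A map is biharmonic if its bitension field $$\tau_2(\varphi)=\mathrm{Trace}_g(\nabla^\varphi\nabla^\varphi-\nabla^\varphi_{\nabla^M})\tau(\varphi)-\mathrm{Trace}_g R^N(d\varphi,\tau(\varphi))d\varphi$$ vanishes, where $\tau(\varphi)=\mathrm{Trace}_g\nabla d\varphi$, and proper biharmonic if moreover $\tau(\varphi)\not\equiv0$. **Theorem.** Let $f:\Sigma\to(0,\infty)$ be smooth such that $f^{1/2}$ is nonconstant and the conformal immersion $\varphi:(\Sigma,\bar g=f^{-1}\varphi^*h)\to M^3(m,l)$ is proper biharmonic. Then $l=0$, $H(s,z)=\kappa(s)/2$ on $\Sigma$, and one of the following holds. (i) $\kappa$ is a nonzero constant with $\kappa^2-4m>0$, and $f=d_1e^{z\sqrt{\kappa^2-4m}}+d_2e^{-z\sqrt{\kappa^2-4m}}$ with constants $d_1,d_2$, $d_1^2+d_2^2\ne0$. (ii) $\kappa$ is nonconstant and nowhere zero, and there is a constant $K$ such that $f(s,z)=\psi(z)\,|\kappa(s)|^{-3/2}$, where $\psi>0$ on $J$ and $$|\kappa(s)|=\begin{cases}\dfrac1{C_1e^{2\sqrt{-(4m+K)}\,s}+D_1e^{-2\sqrt{-(4m+K)}\,s}+\varepsilon\sqrt{4C_1D_1+\frac1{4m+K}}},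 & 4m+K<0,\\[3mm] \dfrac{4C_2}{16+C_2^2(s+D_2)^2}, & 4m+K=0,\\[3mm] \dfrac1{C_3\cos(2\sqrt{4m+K}\,s)+D_3\sin(2\sqrt{4m+K}\,s)+\sqrt{\frac1{4m+K}+C_3^2+D_3^2}}, & 4m+K>0,\end{cases}$$ $$\psi(z)=\begin{cases}a_3\sin(\sqrt{-K}\,z)+b_3\cos(\sqrt{-K}\,z), & K<0,\\ a_2z+b_2, & K=0,\\ a_1e^{\sqrt K z}+b_1e^{-\sqrt K z}, & K>0,\end{cases}$$ with real constants $a_i,b_i,C_i,D_i$, a sign $\varepsilon\in\{1,-1\}$, and $4C_1D_1+\frac1{4m+K}\ge0$ in the first case. (iii) (Only if $J\neq\mathbb R$, i.e. never for a full Hopf cylinder.) $\kappa$ is a nonzero constant with $\kappa^2-4m\le0$, and $f(s,z)=\psi(z)$ with $\psi$ as in the table above for $K=\kappa^2-4m$. -/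

import Mathlib

open scoped ContDiff

noncomputable section

namespace HopfBCV

/-! ### Riemannian geometry in coordinates

A Riemannian metric on an open subset of `ℝⁿ` is given by its coefficient matrix `g p`.
Vectors and vector fields along maps are given by their coordinate components. -/

/-- The partial derivative `∂ᵢ u` at `p`. -/
def pd {d : ℕ} (i : Fin d) (u : (Fin d → ℝ) → ℝ) (p : Fin d → ℝ) : ℝ :=
  fderiv ℝ u p (Pi.single i 1)

/-- The Riemannian inner product `⟨v, w⟩` at `p`. -/
def ip {n : ℕ} (h : (Fin n → ℝ) → Matrix (Fin n) (Fin n) ℝ) (p v w : Fin n → ℝ) : ℝ :=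
  ∑ a, ∑ b, h p a b * v a * w b

/-- The Christoffel symbol `Γᵏᵢⱼ` of the metric `g` at `p`. -/
def christoffel {n : ℕ} (g : (Fin n → ℝ) → Matrix (Fin n) (Fin n) ℝ)
    (k i j : Fin n) (p : Fin n → ℝ) : ℝ :=
  (1 / 2) * ∑ r, (g p)⁻¹ k r *
    (pd i (fun q => g q j r) p + pd j (fun q => g q i r) p - pd r (fun q => g q i j) p)

/-- The coefficient `Rᵃ_{c i j}` of the curvature operator
`R(X,Y)Z = [∇_X,∇_Y]Z - ∇_{[X,Y]}Z`, i.e. `R(∂ᵢ,∂ⱼ)∂_c = ∑ₐ Rᵃ_{c i j} ∂ₐ`. -/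
def curvature {n : ℕ} (h : (Fin n → ℝ) → Matrix (Fin n) (Fin n) ℝ)
    (a c i j : Fin n) (p : Fin n → ℝ) : ℝ :=
  pd i (christoffel h a j c) p - pd j (christoffel h a i c) p
    + ∑ e, (christoffel h a i e p * christoffel h e j c p
      - christoffel h a j e p * christoffel h e i c p)

/-- The vector `R(X,Y)Z` at `p`. -/
def curvatureOp {n : ℕ} (h : (Fin n → ℝ) → Matrix (Fin n) (Fin n) ℝ)
    (p X Y Z : Fin n → ℝ) (a : Fin n) : ℝ :=
  ∑ i, ∑ j, ∑ c, curvature h a c i j p * X i * Y j * Z c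

/-- The vector field `dφ(∂ᵢ)` along `φ`. -/
def dmap {d n : ℕ} (φ : (Fin d → ℝ) → (Fin n → ℝ)) (i : Fin d) (p : Fin d → ℝ) :
    Fin n → ℝ :=
  fun a => pd i (fun q => φ q a) p

/-- The pulled-back connection: `∇^φ_{∂ᵢ} V` for a vector field `V` along `φ`. -/
def covAlong {d n : ℕ} (h : (Fin n → ℝ) → Matrix (Fin n) (Fin n) ℝ)
    (φ : (Fin d → ℝ) → (Fin n → ℝ)) (i : Fin d) (V : (Fin d → ℝ) → (Fin n → ℝ))
    (p : Fin d → ℝ) : Fin n → ℝ :=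
  fun a => pd i (fun q => V q a) p
    + ∑ b, ∑ c, christoffel h a b c (φ p) * dmap φ i p b * V p c

/-- The tension field `τ(φ) = Trace_g ∇dφ` of `φ : (M, g) → (N, h)`. -/
def tension {d n : ℕ} (g : (Fin d → ℝ) → Matrix (Fin d) (Fin d) ℝ)
    (h : (Fin n → ℝ) → Matrix (Fin n) (Fin n) ℝ) (φ : (Fin d → ℝ) → (Fin n → ℝ))
    (p : Fin d → ℝ) : Fin n → ℝ :=
  fun a => ∑ i, ∑ j, (g p)⁻¹ i j *
    (covAlong h φ i (dmap φ j) p a - ∑ k, christoffel g k i j p * dmap φ k p a)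

/-- The bitension field
`τ₂(φ) = Trace_g (∇^φ ∇^φ - ∇^φ_{∇^M}) τ(φ) - Trace_g R^N(dφ, τ(φ)) dφ`. -/
def bitension {d n : ℕ} (g : (Fin d → ℝ) → Matrix (Fin d) (Fin d) ℝ)
    (h : (Fin n → ℝ) → Matrix (Fin n) (Fin n) ℝ) (φ : (Fin d → ℝ) → (Fin n → ℝ))
    (p : Fin d → ℝ) : Fin n → ℝ :=
  fun a => ∑ i, ∑ j, (g p)⁻¹ i j *
    (covAlong h φ i (covAlong h φ j (tension g h φ)) p a
      - (∑ k, christoffel g k i j p * covAlong h φ k (tension g h φ) p a)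
      - curvatureOp h (φ p) (dmap φ i p) (tension g h φ p) (dmap φ j p) a)

/-- `φ : (U, g) → (N, h)` is harmonic. -/
def IsHarmonicMap {d n : ℕ} (U : Set (Fin d → ℝ))
    (g : (Fin d → ℝ) → Matrix (Fin d) (Fin d) ℝ)
    (h : (Fin n → ℝ) → Matrix (Fin n) (Fin n) ℝ) (φ : (Fin d → ℝ) → (Fin n → ℝ)) : Prop :=
  ∀ p ∈ U, tension g h φ p = 0

/-- `φ : (U, g) → (N, h)` is biharmonic. -/
def IsBiharmonicMap {d n : ℕ} (U : Set (Fin d → ℝ))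
    (g : (Fin d → ℝ) → Matrix (Fin d) (Fin d) ℝ)
    (h : (Fin n → ℝ) → Matrix (Fin n) (Fin n) ℝ) (φ : (Fin d → ℝ) → (Fin n → ℝ)) : Prop :=
  ∀ p ∈ U, bitension g h φ p = 0

/-- `φ : (U, g) → (N, h)` is proper biharmonic: biharmonic and not harmonic. -/
def IsProperBiharmonicMap {d n : ℕ} (U : Set (Fin d → ℝ))
    (g : (Fin d → ℝ) → Matrix (Fin d) (Fin d) ℝ)
    (h : (Fin n → ℝ) → Matrix (Fin n) (Fin n) ℝ) (φ : (Fin d → ℝ) → (Fin n → ℝ)) : Prop :=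
  IsBiharmonicMap U g h φ ∧ ¬ IsHarmonicMap U g h φ

/-- The pull-back metric `φ^*h`. -/
def pullbackMetric {d n : ℕ} (h : (Fin n → ℝ) → Matrix (Fin n) (Fin n) ℝ)
    (φ : (Fin d → ℝ) → (Fin n → ℝ)) (p : Fin d → ℝ) : Matrix (Fin d) (Fin d) ℝ :=
  Matrix.of fun i j => ip h (φ p) (dmap φ i p) (dmap φ j p)

/-- The mean curvature `½ Trace_g ⟨∇dφ, ξ⟩`, `g = φ^*h`, of the surface `φ` with respect to
the unit normal field `ξ` along `φ`. -/
def meanCurvature {n : ℕ} (h : (Fin n → ℝ) → Matrix (Fin n) (Fin n) ℝ)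
    (φ ξ : (Fin 2 → ℝ) → (Fin n → ℝ)) (p : Fin 2 → ℝ) : ℝ :=
  (1 / 2) * ∑ i, ∑ j, (pullbackMetric h φ p)⁻¹ i j *
    ip h (φ p) (covAlong h φ i (dmap φ j) p) (ξ p)

/-- The velocity `c'(s)` of a curve. -/
def vel {n : ℕ} (c : ℝ → (Fin n → ℝ)) (s : ℝ) : Fin n → ℝ :=
  fun a => deriv (fun t => c t a) s

/-- The covariant acceleration `∇_{c'} c'` of a curve. -/
def covAccel {n : ℕ} (h : (Fin n → ℝ) → Matrix (Fin n) (Fin n) ℝ)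
    (c : ℝ → (Fin n → ℝ)) (s : ℝ) : Fin n → ℝ :=
  fun a => deriv (fun t => vel c t a) s
    + ∑ i, ∑ j, christoffel h a i j (c s) * vel c s i * vel c s j

/-! ### BCV spaces and Hopf cylinders -/

/-- `F = 1 + m (x² + y²)`. -/
def conf (m x y : ℝ) : ℝ := 1 + m * (x ^ 2 + y ^ 2)

/-- The metric `(dx² + dy²) / F²` of the base surface. -/
def baseMetric (m : ℝ) (p : Fin 2 → ℝ) : Matrix (Fin 2) (Fin 2) ℝ :=
  !![1 / conf m (p 0) (p 1) ^ 2, 0; 0, 1 / conf m (p 0) (p 1) ^ 2]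

/-- The rows are the one-forms `dx / F`, `dy / F`, `dz + (l/2) (y dx - x dy) / F`. -/
def bcvCoframe (m l : ℝ) (p : Fin 3 → ℝ) : Matrix (Fin 3) (Fin 3) ℝ :=
  !![1 / conf m (p 0) (p 1), 0, 0;
     0, 1 / conf m (p 0) (p 1), 0;
     l / 2 * p 1 / conf m (p 0) (p 1), -(l / 2 * p 0 / conf m (p 0) (p 1)), 1]

/-- The metric of the BCV space `M³(m, l)`: the sum of the squares of the coframe forms. -/
def bcvMetric (m l : ℝ) (p : Fin 3 → ℝ) : Matrix (Fin 3) (Fin 3) ℝ :=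
  (bcvCoframe m l p).transpose * bcvCoframe m l p

/-- The parameter domain `I × J` of the surface, with coordinates `s = p 0`, `z = p 1`. -/
def cylinderDomain (I J : Set ℝ) : Set (Fin 2 → ℝ) := {p | p 0 ∈ I ∧ p 1 ∈ J}

/-- The Hopf cylinder `φ(s, z) = (x(s), y(s), z)` over the curve `γ = (x, y)`. -/
def hopfCylinder (γ : ℝ → (Fin 2 → ℝ)) (p : Fin 2 → ℝ) : Fin 3 → ℝ :=
  ![γ (p 0) 0, γ (p 0) 1, p 1]

/-- The unit normal field `ξ = (y'/F) E₁ - (x'/F) E₂` of the Hopf cylinder, where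
`E₁ = F ∂ₓ - (l y / 2) ∂_z` and `E₂ = F ∂_y + (l x / 2) ∂_z`. -/
def hopfNormal (m l : ℝ) (γ : ℝ → (Fin 2 → ℝ)) (p : Fin 2 → ℝ) : Fin 3 → ℝ :=
  let x := γ (p 0) 0
  let y := γ (p 0) 1
  let F := conf m x y
  let E₁ : Fin 3 → ℝ := ![F, 0, -(l * y / 2)]
  let E₂ : Fin 3 → ℝ := ![0, F, l * x / 2]
  (vel γ (p 0) 1 / F) • E₁ - (vel γ (p 0) 0 / F) • E₂

/-- The signed geodesic curvature `κ` of the unit speed curve `γ` in the base surface, with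
respect to the unit normal `y' ∂ₓ - x' ∂_y` (the projection of the normal `ξ` of the Hopf
cylinder). -/
def geodCurv (m : ℝ) (γ : ℝ → (Fin 2 → ℝ)) (s : ℝ) : ℝ :=
  ip (baseMetric m) (γ s) (covAccel (baseMetric m) γ s) ![vel γ s 1, -vel γ s 0]

/-! ### The explicit solutions -/

/-- The explicit curvature functions `k(s, m, K)`. -/
def IsCurvatureSolution (m K : ℝ) (I : Set ℝ) (k : ℝ → ℝ) : Prop :=
  (4 * m + K < 0 ∧ ∃ C D ε : ℝ, (ε = 1 ∨ ε = -1) ∧ 0 ≤ 4 * C * D + 1 / (4 * m + K) ∧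
    ∀ s ∈ I, k s = 1 / (C * Real.exp (2 * √(-(4 * m + K)) * s)
      + D * Real.exp (-(2 * √(-(4 * m + K)) * s))
      + ε * √(4 * C * D + 1 / (4 * m + K)))) ∨
  (4 * m + K = 0 ∧ ∃ C D : ℝ,
    ∀ s ∈ I, k s = 4 * C / (16 + C ^ 2 * (s + D) ^ 2)) ∨
  (0 < 4 * m + K ∧ ∃ C D : ℝ,
    ∀ s ∈ I, k s = 1 / (C * Real.cos (2 * √(4 * m + K) * s)
      + D * Real.sin (2 * √(4 * m + K) * s)
      + √(1 / (4 * m + K) + (C ^ 2 + D ^ 2))))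

/-- The explicit functions `ψ(z, K)`. -/
def IsFibreSolution (K : ℝ) (J : Set ℝ) (ψ : ℝ → ℝ) : Prop :=
  (K < 0 ∧ ∃ a b : ℝ, ∀ z ∈ J, ψ z = a * Real.sin (√(-K) * z) + b * Real.cos (√(-K) * z)) ∨
  (K = 0 ∧ ∃ a b : ℝ, ∀ z ∈ J, ψ z = a * z + b) ∨
  (0 < K ∧ ∃ a b : ℝ, ∀ z ∈ J, ψ z = a * Real.exp (√K * z) + b * Real.exp (-(√K * z)))

end HopfBCV

end

noncomputable section

namespace HopfBCV

/-! ### Calculus rules for coordinate partial derivatives. -/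

section PartialDerivatives

variable {d : ℕ} {i : Fin d} {u v : (Fin d → ℝ) → ℝ} {p : Fin d → ℝ}

/-! Along the cylinder take the orthonormal frame X (horizontal lift of γ'), V = ∂_z, ξ. With t =
`tilt`, dφ(∂_s) = X + tV and dφ(∂_z) = V, so the induced metric is flat and the frame rotates only
into ξ. Rescaling by 1/f multiplies the tension field by f in dimension two, so τ(φ) = uξ with u =
fκ. Writing Xu = u_s - t u_z, `bitension_hopfCylinder` turns biharmonicity into three scalar
equations: 2κ Xu + l u_z + κ'u = 0, l Xu = 0, and Δu = (κ² + l² - 4m)u, where Δ is the flat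
Laplacian.

If l ≠ 0, then Xu = 0 and u_z = au with a = -κ'/l. Equality of mixed partials gives a'u = 0, and the
Laplace equation gives a²u = (κ² + l² - 4m)u; differentiating the latter where κ ≠ 0 yields κκ' = 0.
Then κ, u and finally f are constant, which is excluded (`eq_zero_of_proper`).

If l = 0, the first equation says that f²κ³ depends on z only. Hence κ vanishes nowhere, and f =
ψ(z)w(s)³ with w = |κ|^(-1/2). The Laplace equation then separates (`exists_separation`) into ψ'' =
Kψ and the Ermakov equation w'' = w⁻³ - (4m + K)w. The latter has a conserved energy e, which makes
v = w² = 1/|κ| a solution of the linear equation v'' = 2e - 4(4m + K)v; solving it gives the table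
for |κ| (`isCurvatureSolution_one_div`). For constant κ the Ermakov equation forces K = κ² - 4m. If
moreover K ≤ 0 and J is the whole line, positivity makes ψ, hence f, constant. -/

theorem pd_const (c : ℝ) : pd i (fun _ => c) p = 0 := by simp [pd]

theorem pd_coord (j : Fin d) : pd i (fun q => q j) p = if i = j then 1 else 0 := by
  have h : HasFDerivAt (fun q : Fin d → ℝ => q j)
      (ContinuousLinearMap.proj (R := ℝ) (φ := fun _ : Fin d => ℝ) j) p :=
    (ContinuousLinearMap.proj (R := ℝ) (φ := fun _ : Fin d => ℝ) j).hasFDerivAt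
  rw [pd, h.fderiv, ContinuousLinearMap.proj_apply, Pi.single_apply]
  simp only [eq_comm]

theorem pd_add (hu : DifferentiableAt ℝ u p) (hv : DifferentiableAt ℝ v p) :
    pd i (fun q => u q + v q) p = pd i u p + pd i v p := by
  simp [pd, fderiv_fun_add hu hv]

theorem pd_sub (hu : DifferentiableAt ℝ u p) (hv : DifferentiableAt ℝ v p) :
    pd i (fun q => u q - v q) p = pd i u p - pd i v p := by
  simp [pd, fderiv_fun_sub hu hv]

theorem pd_neg : pd i (fun q => -u q) p = -pd i u p := by
  simp [pd, fderiv_fun_neg]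

theorem pd_mul (hu : DifferentiableAt ℝ u p) (hv : DifferentiableAt ℝ v p) :
    pd i (fun q => u q * v q) p = u p * pd i v p + pd i u p * v p := by
  simp [pd, fderiv_fun_mul hu hv, mul_comm]

theorem pd_pow_two (hu : DifferentiableAt ℝ u p) :
    pd i (fun q => u q ^ 2) p = 2 * u p * pd i u p := by
  simp only [pow_two, pd_mul hu hu]; ring

theorem pd_inv (hu : DifferentiableAt ℝ u p) (h : u p ≠ 0) :
    pd i (fun q => (u q)⁻¹) p = -pd i u p / u p ^ 2 := by
  have := (hasDerivAt_inv h).comp_hasFDerivAt p hu.hasFDerivAt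
  have e := this.fderiv
  simp only [Function.comp_def] at e
  rw [pd, e]
  simp [pd]
  ring

theorem pd_div (hu : DifferentiableAt ℝ u p) (hv : DifferentiableAt ℝ v p) (h : v p ≠ 0) :
    pd i (fun q => u q / v q) p = (pd i u p * v p - u p * pd i v p) / v p ^ 2 := by
  simp only [div_eq_mul_inv (u _)]
  rw [pd_mul hu (hv.fun_inv h), pd_inv hv h]
  field_simp
  ring

theorem pd_congr (h : u =ᶠ[nhds p] v) : pd i u p = pd i v p := by
  rw [pd, pd, h.fderiv_eq]

end PartialDerivatives

/-! ### The Levi-Civita connection of the BCV space -/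

@[fun_prop]
theorem differentiableAt_conf {E : Type*} [NormedAddCommGroup E] [NormedSpace ℝ E] (m : ℝ)
    {u v : E → ℝ} {p : E} (hu : DifferentiableAt ℝ u p) (hv : DifferentiableAt ℝ v p) :
    DifferentiableAt ℝ (fun q => conf m (u q) (v q)) p := by
  unfold conf; fun_prop

theorem pd_conf {d : ℕ} (m : ℝ) (a b i : Fin d) (p : Fin d → ℝ) :
    pd i (fun q => conf m (q a) (q b)) p =
      2 * m * (p a * (if i = a then 1 else 0) + p b * (if i = b then 1 else 0)) := by
  unfold conf
  simp (disch := fun_prop) only [pd_add, pd_mul, pd_pow_two, pd_const, pd_coord]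
  ring

theorem bcvMetric_eq (m l : ℝ) (p : Fin 3 → ℝ) :
    bcvMetric m l p =
      !![(1 / conf m (p 0) (p 1)) ^ 2 + (l / 2 * p 1 / conf m (p 0) (p 1)) ^ 2,
          -(l / 2 * p 1 / conf m (p 0) (p 1) * (l / 2 * p 0 / conf m (p 0) (p 1))),
          l / 2 * p 1 / conf m (p 0) (p 1);
        -(l / 2 * p 1 / conf m (p 0) (p 1) * (l / 2 * p 0 / conf m (p 0) (p 1))),
          (1 / conf m (p 0) (p 1)) ^ 2 + (l / 2 * p 0 / conf m (p 0) (p 1)) ^ 2,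
          -(l / 2 * p 0 / conf m (p 0) (p 1));
        l / 2 * p 1 / conf m (p 0) (p 1), -(l / 2 * p 0 / conf m (p 0) (p 1)), 1] := by
  ext i j
  fin_cases i <;> fin_cases j <;>
    simp [bcvMetric, bcvCoframe, Matrix.mul_apply, Fin.sum_univ_three] <;> ring

theorem bcvMetric_inv (m l : ℝ) (p : Fin 3 → ℝ) (hF : conf m (p 0) (p 1) ≠ 0) :
    (bcvMetric m l p)⁻¹ =
      !![conf m (p 0) (p 1) ^ 2, 0, -(l / 2 * p 1 * conf m (p 0) (p 1));
        0, conf m (p 0) (p 1) ^ 2, l / 2 * p 0 * conf m (p 0) (p 1);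
        -(l / 2 * p 1 * conf m (p 0) (p 1)), l / 2 * p 0 * conf m (p 0) (p 1),
          1 + (l / 2) ^ 2 * (p 0 ^ 2 + p 1 ^ 2)] := by
  apply Matrix.inv_eq_right_inv
  rw [bcvMetric_eq]
  ext i j
  fin_cases i <;> fin_cases j <;>
    simp [Matrix.mul_apply, Fin.sum_univ_three] <;> field_simp <;> ring

/-- The partial derivatives of the metric coefficients of the BCV space. -/
def bcvMetricDeriv (m l : ℝ) (p : Fin 3 → ℝ) : Fin 3 → Fin 3 → Fin 3 → ℝ :=
  let x := p 0
  let y := p 1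
  let F := conf m x y
  ![![![-4 * m * x - m * x * l ^ 2 * y ^ 2, -(l ^ 2 / 4 * y * (F - 4 * m * x ^ 2)),
        -(m * l * x * y * F)],
      ![-(l ^ 2 / 4 * y * (F - 4 * m * x ^ 2)),
        -4 * m * x + l ^ 2 / 2 * x * (F - 2 * m * x ^ 2), -(l / 2 * (F - 2 * m * x ^ 2) * F)],
      ![-(m * l * x * y * F), -(l / 2 * (F - 2 * m * x ^ 2) * F), 0]],
    ![![-4 * m * y + l ^ 2 / 2 * y * (F - 2 * m * y ^ 2),
        -(l ^ 2 / 4 * x * (F - 4 * m * y ^ 2)), l / 2 * (F - 2 * m * y ^ 2) * F],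
      ![-(l ^ 2 / 4 * x * (F - 4 * m * y ^ 2)), -4 * m * y - m * y * l ^ 2 * x ^ 2,
        m * l * x * y * F],
      ![l / 2 * (F - 2 * m * y ^ 2) * F, m * l * x * y * F, 0]],
    ![![0, 0, 0], ![0, 0, 0], ![0, 0, 0]]]

/-- All first derivatives share the denominator F³; the table `bcvMetricDeriv` stores only the
numerators. -/
theorem pd_bcvMetric (m l : ℝ) (p : Fin 3 → ℝ) (hF : conf m (p 0) (p 1) ≠ 0)
    (i j k : Fin 3) :
    pd i (fun q => bcvMetric m l q j k) p =
      bcvMetricDeriv m l p i j k / conf m (p 0) (p 1) ^ 3 := by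
  simp only [bcvMetric_eq]
  fin_cases i <;> fin_cases j <;> fin_cases k <;>
    simp only [Matrix.of_apply, Matrix.cons_val', Matrix.cons_val, Matrix.cons_val_zero,
      Matrix.cons_val_one, Fin.zero_eta, Fin.mk_one, Fin.reduceFinMk, Matrix.cons_val_fin_one] <;>
    simp (disch := first | assumption | fun_prop (disch := assumption)) only
      [pd_add, pd_mul, pd_pow_two, pd_const, pd_coord, pd_div, pd_neg, pd_conf] <;>
    simp [bcvMetricDeriv] <;> field_simp <;> ring

/-- The Christoffel symbols of the BCV space. -/
def bcvChristoffel (m l : ℝ) (p : Fin 3 → ℝ) : Fin 3 → Fin 3 → Fin 3 → ℝ :=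
  let x := p 0
  let y := p 1
  let F := conf m x y
  ![![![-(2 * m * x) / F, (l ^ 2 / 4 - 2 * m) * y / F, 0],
      ![(l ^ 2 / 4 - 2 * m) * y / F, (2 * m - l ^ 2 / 2) * x / F, l / 2],
      ![0, l / 2, 0]],
    ![![(2 * m - l ^ 2 / 2) * y / F, (l ^ 2 / 4 - 2 * m) * x / F, -(l / 2)],
      ![(l ^ 2 / 4 - 2 * m) * x / F, -(2 * m * y) / F, 0],
      ![-(l / 2), 0, 0]],
    ![![l * (m - l ^ 2 / 4) * x * y / F ^ 2, l / 2 * (m - l ^ 2 / 4) * (y ^ 2 - x ^ 2) / F ^ 2,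
        -(l ^ 2 / 4 * x) / F],
      ![l / 2 * (m - l ^ 2 / 4) * (y ^ 2 - x ^ 2) / F ^ 2, -(l * (m - l ^ 2 / 4) * x * y) / F ^ 2,
        -(l ^ 2 / 4 * y) / F],
      ![-(l ^ 2 / 4 * x) / F, -(l ^ 2 / 4 * y) / F, 0]]]

theorem christoffel_bcvMetric (m l : ℝ) (p : Fin 3 → ℝ) (hF : conf m (p 0) (p 1) ≠ 0)
    (k i j : Fin 3) :
    christoffel (bcvMetric m l) k i j p = bcvChristoffel m l p k i j := by
  simp only [christoffel, pd_bcvMetric m l p hF, bcvMetric_inv m l p hF, Fin.sum_univ_three]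
  fin_cases k <;> fin_cases i <;> fin_cases j <;>
    simp [bcvMetricDeriv, bcvChristoffel] <;> field_simp <;> (try simp only [conf]) <;> ring

theorem eventually_conf_ne_zero {d : ℕ} {m : ℝ} {a b : Fin d} {p : Fin d → ℝ}
    (hF : conf m (p a) (p b) ≠ 0) : ∀ᶠ q in nhds p, conf m (q a) (q b) ≠ 0 :=
  (show DifferentiableAt ℝ (fun q : Fin d → ℝ => conf m (q a) (q b)) p by
    fun_prop).continuousAt.eventually_ne hF

theorem curvature_antisymm {n : ℕ} (h : (Fin n → ℝ) → Matrix (Fin n) (Fin n) ℝ)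
    (a c i j : Fin n) (p : Fin n → ℝ) : curvature h a c j i p = -curvature h a c i j p := by
  simp only [curvature, neg_add, ← Finset.sum_neg_distrib, neg_sub]

/-- The one-form `dz + (l/2) (y dx - x dy) / F`. -/
def contactForm (m l : ℝ) (p : Fin 3 → ℝ) : Fin 3 → ℝ :=
  ![l / 2 * p 1 / conf m (p 0) (p 1), -(l / 2 * p 0 / conf m (p 0) (p 1)), 1]

/-- The curvature tensor of the BCV space in terms of the metric and the contact form. -/
def bcvCurvature (m l : ℝ) (p : Fin 3 → ℝ) (a c i j : Fin 3) : ℝ :=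
  let h := bcvMetric m l p
  let η := contactForm m l p
  let δ : Fin 3 → Fin 3 → ℝ := fun r s => if r = s then 1 else 0
  (4 * m - 3 * l ^ 2 / 4) * (h j c * δ a i - h i c * δ a j)
    - (4 * m - l ^ 2) * (η j * η c * δ a i - η i * η c * δ a j
      + (h j c * η i - h i c * η j) * δ a 2)

theorem bcvCurvature_antisymm (m l : ℝ) (p : Fin 3 → ℝ) (a c i j : Fin 3) :
    bcvCurvature m l p a c j i = -bcvCurvature m l p a c i j := by
  simp only [bcvCurvature]; ring

/-- F ≠ 0 is an open condition, so the closed form of the symbols may be differentiated. -/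
theorem pd_christoffel_bcvMetric (m l : ℝ) (p : Fin 3 → ℝ) (hF : conf m (p 0) (p 1) ≠ 0)
    (i k a b : Fin 3) :
    pd i (christoffel (bcvMetric m l) k a b) p = pd i (fun q => bcvChristoffel m l q k a b) p :=
  pd_congr ((eventually_conf_ne_zero hF).mono fun q hq => christoffel_bcvMetric m l q hq k a b)

theorem curvature_bcvMetric_zero_one (m l : ℝ) (p : Fin 3 → ℝ)
    (hF : conf m (p 0) (p 1) ≠ 0) (a c : Fin 3) :
    curvature (bcvMetric m l) a c 0 1 p = bcvCurvature m l p a c 0 1 := by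
  have hF' := pow_ne_zero 2 hF
  simp only [curvature, pd_christoffel_bcvMetric m l p hF, christoffel_bcvMetric m l p hF,
    Fin.sum_univ_three]
  fin_cases a <;> fin_cases c <;>
    simp only [bcvChristoffel, Matrix.cons_val', Matrix.cons_val, Matrix.cons_val_zero,
      Matrix.cons_val_one, Fin.zero_eta, Fin.mk_one, Fin.reduceFinMk, Matrix.cons_val_fin_one] <;>
    (try simp (disch := first | assumption | fun_prop (disch := assumption)) only
      [pd_sub, pd_mul, pd_pow_two, pd_const, pd_coord, pd_div, pd_neg, pd_conf]) <;>
    simp [bcvCurvature, bcvMetric_eq, contactForm] <;> field_simp <;>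
    (try simp only [conf]) <;> ring

theorem curvature_bcvMetric_zero_two (m l : ℝ) (p : Fin 3 → ℝ)
    (hF : conf m (p 0) (p 1) ≠ 0) (a c : Fin 3) :
    curvature (bcvMetric m l) a c 0 2 p = bcvCurvature m l p a c 0 2 := by
  have hF' := pow_ne_zero 2 hF
  simp only [curvature, pd_christoffel_bcvMetric m l p hF, christoffel_bcvMetric m l p hF,
    Fin.sum_univ_three]
  fin_cases a <;> fin_cases c <;>
    simp only [bcvChristoffel, Matrix.cons_val', Matrix.cons_val, Matrix.cons_val_zero,
      Matrix.cons_val_one, Fin.zero_eta, Fin.mk_one, Fin.reduceFinMk, Matrix.cons_val_fin_one] <;>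
    (try simp (disch := first | assumption | fun_prop (disch := assumption)) only
      [pd_sub, pd_mul, pd_pow_two, pd_const, pd_coord, pd_div, pd_neg, pd_conf]) <;>
    simp [bcvCurvature, bcvMetric_eq, contactForm] <;> field_simp <;>
    (try simp only [conf]) <;> ring

theorem curvature_bcvMetric_one_two (m l : ℝ) (p : Fin 3 → ℝ)
    (hF : conf m (p 0) (p 1) ≠ 0) (a c : Fin 3) :
    curvature (bcvMetric m l) a c 1 2 p = bcvCurvature m l p a c 1 2 := by
  have hF' := pow_ne_zero 2 hF
  simp only [curvature, pd_christoffel_bcvMetric m l p hF, christoffel_bcvMetric m l p hF,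
    Fin.sum_univ_three]
  fin_cases a <;> fin_cases c <;>
    simp only [bcvChristoffel, Matrix.cons_val', Matrix.cons_val, Matrix.cons_val_zero,
      Matrix.cons_val_one, Fin.zero_eta, Fin.mk_one, Fin.reduceFinMk, Matrix.cons_val_fin_one] <;>
    (try simp (disch := first | assumption | fun_prop (disch := assumption)) only
      [pd_sub, pd_mul, pd_pow_two, pd_const, pd_coord, pd_div, pd_neg, pd_conf]) <;>
    simp [bcvCurvature, bcvMetric_eq, contactForm] <;> field_simp <;>
    (try simp only [conf]) <;> ring

/-- Both sides are antisymmetric in the last two indices, so the three coordinate planes 01, 02, 12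
suffice. -/
theorem curvature_bcvMetric (m l : ℝ) (p : Fin 3 → ℝ) (hF : conf m (p 0) (p 1) ≠ 0)
    (a c i j : Fin 3) : curvature (bcvMetric m l) a c i j p = bcvCurvature m l p a c i j := by
  have key : ∀ i, curvature (bcvMetric m l) a c i i p = bcvCurvature m l p a c i i := by
    intro i
    have h₁ := curvature_antisymm (bcvMetric m l) a c i i p
    have h₂ := bcvCurvature_antisymm m l p a c i i
    linarith
  have h₀₁ := curvature_bcvMetric_zero_one m l p hF a c
  have h₀₂ := curvature_bcvMetric_zero_two m l p hF a c
  have h₁₂ := curvature_bcvMetric_one_two m l p hF a c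
  have anti : ∀ i j, curvature (bcvMetric m l) a c i j p = bcvCurvature m l p a c i j →
      curvature (bcvMetric m l) a c j i p = bcvCurvature m l p a c j i := by
    intro i j h
    rw [curvature_antisymm, bcvCurvature_antisymm, h]
  fin_cases i <;> fin_cases j
  exacts [key 0, h₀₁, h₀₂, anti 0 1 h₀₁, key 1, h₁₂, anti 0 2 h₀₂, anti 1 2 h₁₂, key 2]

/-! ### Curves in the base surface -/

theorem baseMetric_inv (m : ℝ) (p : Fin 2 → ℝ) (hF : conf m (p 0) (p 1) ≠ 0) :
    (baseMetric m p)⁻¹ = !![conf m (p 0) (p 1) ^ 2, 0; 0, conf m (p 0) (p 1) ^ 2] := by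
  apply Matrix.inv_eq_right_inv
  ext i j
  fin_cases i <;> fin_cases j <;>
    simp [baseMetric, Matrix.mul_apply, Fin.sum_univ_two] <;> field_simp

theorem pd_inv_conf_sq (m : ℝ) (p : Fin 2 → ℝ) (hF : conf m (p 0) (p 1) ≠ 0) (i : Fin 2) :
    pd i (fun q => 1 / conf m (q 0) (q 1) ^ 2) p = -4 * m * p i / conf m (p 0) (p 1) ^ 3 := by
  have hF' := pow_ne_zero 2 hF
  simp (disch := first | assumption | fun_prop (disch := assumption)) only
    [pd_pow_two, pd_const, pd_div, pd_conf]
  fin_cases i <;> simp <;> field_simp <;> ring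

theorem christoffel_baseMetric (m : ℝ) (p : Fin 2 → ℝ) (hF : conf m (p 0) (p 1) ≠ 0)
    (k i j : Fin 2) :
    christoffel (baseMetric m) k i j p = -(2 * m) / conf m (p 0) (p 1) *
      ((if j = k then p i else 0) + (if i = k then p j else 0) - if i = j then p k else 0) := by
  have h : ∀ i j k, pd i (fun q => baseMetric m q j k) p =
      if j = k then -4 * m * p i / conf m (p 0) (p 1) ^ 3 else 0 := by
    intro i j k
    fin_cases j <;> fin_cases k <;>
      simp only [baseMetric, Matrix.of_apply, Matrix.cons_val', Matrix.cons_val_zero,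
        Matrix.cons_val_one, Fin.zero_eta, Fin.mk_one,
        Matrix.cons_val_fin_one, pd_inv_conf_sq m p hF, pd_const] <;> simp
  simp only [christoffel, h, baseMetric_inv m p hF, Fin.sum_univ_two]
  fin_cases k <;> fin_cases i <;> fin_cases j <;> simp <;> field_simp <;> ring

/-- `γ` is a smooth unit speed curve in the base surface, defined on the open set `I`. -/
structure IsUnitSpeedCurve (m : ℝ) (γ : ℝ → (Fin 2 → ℝ)) (I : Set ℝ) : Prop where
  isOpen : IsOpen I
  contDiffOn : ContDiffOn ℝ ∞ γ I
  conf_ne_zero : ∀ s ∈ I, conf m (γ s 0) (γ s 1) ≠ 0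
  ip_vel : ∀ s ∈ I, ip (baseMetric m) (γ s) (vel γ s) (vel γ s) = 1

namespace IsUnitSpeedCurve

variable {m : ℝ} {γ : ℝ → (Fin 2 → ℝ)} {I : Set ℝ} {s : ℝ}

theorem contDiffOn_apply (h : IsUnitSpeedCurve m γ I) (i : Fin 2) :
    ContDiffOn ℝ ∞ (fun t => γ t i) I :=
  contDiffOn_pi.1 h.contDiffOn i

theorem contDiffOn_vel (h : IsUnitSpeedCurve m γ I) (i : Fin 2) :
    ContDiffOn ℝ ∞ (fun t => vel γ t i) I :=
  (h.contDiffOn_apply i).deriv_of_isOpen h.isOpen (by simp)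

theorem hasDerivAt_apply (h : IsUnitSpeedCurve m γ I) (hs : s ∈ I) (i : Fin 2) :
    HasDerivAt (fun t => γ t i) (vel γ s i) s :=
  (((h.contDiffOn_apply i).contDiffAt (h.isOpen.mem_nhds hs)).differentiableAt
    (by simp)).hasDerivAt

theorem differentiableAt_vel (h : IsUnitSpeedCurve m γ I) (hs : s ∈ I) (i : Fin 2) :
    DifferentiableAt ℝ (fun t => vel γ t i) s :=
  ((h.contDiffOn_vel i).contDiffAt (h.isOpen.mem_nhds hs)).differentiableAt (by simp)

theorem hasDerivAt_conf (h : IsUnitSpeedCurve m γ I) (hs : s ∈ I) :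
    HasDerivAt (fun t => conf m (γ t 0) (γ t 1))
      (2 * m * (γ s 0 * vel γ s 0 + γ s 1 * vel γ s 1)) s := by
  unfold conf
  refine ((((h.hasDerivAt_apply hs 0).pow 2).add
    ((h.hasDerivAt_apply hs 1).pow 2)).const_mul m).const_add 1 |>.congr_deriv ?_
  push_cast; ring

theorem sq_add_sq_vel (h : IsUnitSpeedCurve m γ I) (hs : s ∈ I) :
    vel γ s 0 ^ 2 + vel γ s 1 ^ 2 = conf m (γ s 0) (γ s 1) ^ 2 := by
  have h₁ := h.ip_vel s hs
  have h₂ := h.conf_ne_zero s hs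
  simp only [ip, baseMetric, Fin.sum_univ_two] at h₁
  simp at h₁
  field_simp at h₁
  linarith

/-- A unit speed curve satisfies `∇_{γ'} γ' = κ (y' ∂ₓ - x' ∂_y)`. -/
theorem covAccel_eq (h : IsUnitSpeedCurve m γ I) (hs : s ∈ I) :
    covAccel (baseMetric m) γ s 0 = geodCurv m γ s * vel γ s 1 ∧
      covAccel (baseMetric m) γ s 1 = -(geodCurv m γ s * vel γ s 0) := by
  have hF := h.conf_ne_zero s hs
  have hsq := h.sq_add_sq_vel hs
  -- Differentiating the unit speed relation x'² + y'² = F² shows that the acceleration is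
  -- orthogonal to γ'.
  have horth : covAccel (baseMetric m) γ s 0 * vel γ s 0
      + covAccel (baseMetric m) γ s 1 * vel γ s 1 = 0 := by
    have h₁ := (((h.differentiableAt_vel hs 0).hasDerivAt.pow 2).add
      ((h.differentiableAt_vel hs 1).hasDerivAt.pow 2)).sub ((h.hasDerivAt_conf hs).pow 2)
    have h₂ := h₁.unique ((hasDerivAt_const s (0 : ℝ)).congr_of_eventuallyEq
      (Filter.eventuallyEq_of_mem (h.isOpen.mem_nhds hs) fun t ht => by
        simpa [sub_eq_zero] using h.sq_add_sq_vel ht))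
    simp only [covAccel, christoffel_baseMetric m _ hF, Fin.sum_univ_two]
    simp at h₂ ⊢
    field_simp
    linear_combination conf m (γ s 0) (γ s 1) / 2 * h₂
      - 2 * m * (γ s 0 * vel γ s 0 + γ s 1 * vel γ s 1) * hsq
  have hκ : geodCurv m γ s * conf m (γ s 0) (γ s 1) ^ 2 =
      covAccel (baseMetric m) γ s 0 * vel γ s 1 - covAccel (baseMetric m) γ s 1 * vel γ s 0 := by
    simp only [geodCurv, ip, baseMetric, Fin.sum_univ_two]
    simp
    field_simp
    ring
  have hF' := pow_ne_zero 2 hF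
  generalize covAccel (baseMetric m) γ s 0 = a at *
  generalize covAccel (baseMetric m) γ s 1 = b at *
  -- The products of (a, b) with the orthogonal vectors (x', y') and (y', -x') are known, and both
  -- vectors have squared Euclidean length F², so a and b can be solved for.
  constructor
  · apply mul_left_cancel₀ hF'
    linear_combination vel γ s 0 * horth - vel γ s 1 * hκ - a * hsq
  · apply mul_left_cancel₀ hF'
    linear_combination vel γ s 1 * horth + vel γ s 0 * hκ - b * hsq

/-- The second derivatives of the coordinates of a unit speed curve. -/
theorem hasDerivAt_vel (h : IsUnitSpeedCurve m γ I) (hs : s ∈ I) :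
    HasDerivAt (fun t => vel γ t 0) (geodCurv m γ s * vel γ s 1
      + 2 * m / conf m (γ s 0) (γ s 1) * (γ s 0 * (vel γ s 0 ^ 2 - vel γ s 1 ^ 2)
        + 2 * γ s 1 * vel γ s 0 * vel γ s 1)) s ∧
    HasDerivAt (fun t => vel γ t 1) (-(geodCurv m γ s * vel γ s 0)
      + 2 * m / conf m (γ s 0) (γ s 1) * (γ s 1 * (vel γ s 1 ^ 2 - vel γ s 0 ^ 2)
        + 2 * γ s 0 * vel γ s 0 * vel γ s 1)) s := by
  obtain ⟨h₀, h₁⟩ := h.covAccel_eq hs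
  have hF := h.conf_ne_zero s hs
  simp only [covAccel, christoffel_baseMetric m _ hF, Fin.sum_univ_two] at h₀ h₁
  simp at h₀ h₁
  refine ⟨(h.differentiableAt_vel hs 0).hasDerivAt.congr_deriv ?_,
    (h.differentiableAt_vel hs 1).hasDerivAt.congr_deriv ?_⟩
  · rw [← h₀]; field_simp; ring
  · rw [← h₁]; field_simp; ring

/-- Solving the second-order equations of the curve for κ gives an expression in smooth functions
whose only denominators are powers of F. -/
theorem contDiffOn_geodCurv (h : IsUnitSpeedCurve m γ I) :
    ContDiffOn ℝ ∞ (geodCurv m γ) I := by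
  have hv := h.contDiffOn_vel
  have ha : ∀ i, ContDiffOn ℝ ∞ (fun t => deriv (fun t => vel γ t i) t) I := fun i =>
    (hv i).deriv_of_isOpen h.isOpen (by simp)
  have hc := h.contDiffOn_apply
  have hF : ContDiffOn ℝ ∞ (fun t => conf m (γ t 0) (γ t 1)) I := by
    unfold conf
    exact contDiffOn_const.add (contDiffOn_const.mul (((hc 0).pow 2).add ((hc 1).pow 2)))
  have key : ∀ t ∈ I, geodCurv m γ t = ((deriv (fun t => vel γ t 0) t
      - 2 * m / conf m (γ t 0) (γ t 1) * (γ t 0 * (vel γ t 0 ^ 2 - vel γ t 1 ^ 2)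
        + 2 * γ t 1 * vel γ t 0 * vel γ t 1)) * vel γ t 1
      - (deriv (fun t => vel γ t 1) t
        - 2 * m / conf m (γ t 0) (γ t 1) * (γ t 1 * (vel γ t 1 ^ 2 - vel γ t 0 ^ 2)
        + 2 * γ t 0 * vel γ t 0 * vel γ t 1)) * vel γ t 0) / conf m (γ t 0) (γ t 1) ^ 2 := by
    intro t ht
    rw [(h.hasDerivAt_vel ht).1.deriv, (h.hasDerivAt_vel ht).2.deriv,
      eq_div_iff (pow_ne_zero 2 (h.conf_ne_zero t ht)), ← h.sq_add_sq_vel ht]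
    ring
  refine ContDiffOn.congr ?_ key
  have h₁ := hF.inv h.conf_ne_zero
  simp only [div_eq_mul_inv, ← inv_pow]
  exact ((((ha 0).sub ((contDiffOn_const.mul h₁).mul (((hc 0).mul (((hv 0).pow 2).sub
    ((hv 1).pow 2))).add (((contDiffOn_const.mul (hc 1)).mul (hv 0)).mul (hv 1))))).mul
    (hv 1)).sub (((ha 1).sub ((contDiffOn_const.mul h₁).mul (((hc 1).mul (((hv 1).pow 2).sub
    ((hv 0).pow 2))).add (((contDiffOn_const.mul (hc 0)).mul (hv 0)).mul (hv 1))))).mul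
    (hv 0))).mul (h₁.pow 2)

end IsUnitSpeedCurve

/-! ### The adapted frame along a Hopf cylinder -/

theorem hasDerivAt_pd {d : ℕ} {g : ℝ → ℝ} {g' : ℝ} {p : Fin d → ℝ} {j : Fin d}
    (h : HasDerivAt g g' (p j)) (i : Fin d) :
    DifferentiableAt ℝ (fun q : Fin d → ℝ => g (q j)) p ∧
      pd i (fun q : Fin d → ℝ => g (q j)) p = if i = j then g' else 0 := by
  have hc : HasFDerivAt (fun q : Fin d → ℝ => q j)
      (ContinuousLinearMap.proj (R := ℝ) (φ := fun _ : Fin d => ℝ) j) p :=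
    (ContinuousLinearMap.proj (R := ℝ) (φ := fun _ : Fin d => ℝ) j).hasFDerivAt
  have hg := h.comp_hasFDerivAt p hc
  refine ⟨hg.differentiableAt, ?_⟩
  have := hg.fderiv
  simp only [Function.comp_def] at this
  rw [pd, this]
  simp [Pi.single_apply, eq_comm]

theorem covAlong_congr {d n : ℕ} {h : (Fin n → ℝ) → Matrix (Fin n) (Fin n) ℝ}
    {φ : (Fin d → ℝ) → (Fin n → ℝ)} {i : Fin d} {V W : (Fin d → ℝ) → (Fin n → ℝ)}
    {p : Fin d → ℝ} (hVW : V =ᶠ[nhds p] W) : covAlong h φ i V p = covAlong h φ i W p := by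
  funext a
  simp only [covAlong, hVW.eq_of_nhds]
  rw [pd_congr (u := fun q => V q a) (v := fun q => W q a) (hVW.mono fun q hq => by simp only [hq])]

/-- The vertical component of the velocity of the curve `s ↦ φ(s, z)`. -/
def tilt (m l : ℝ) (γ : ℝ → (Fin 2 → ℝ)) (s : ℝ) : ℝ :=
  l / 2 * (γ s 1 * vel γ s 0 - γ s 0 * vel γ s 1) / conf m (γ s 0) (γ s 1)

/-- Minus the last coordinate of the unit normal of the Hopf cylinder. -/
def normalTilt (m l : ℝ) (γ : ℝ → (Fin 2 → ℝ)) (s : ℝ) : ℝ :=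
  l / 2 * (γ s 0 * vel γ s 0 + γ s 1 * vel γ s 1) / conf m (γ s 0) (γ s 1)

/-- The vector `a X + b V + c ξ`, where `X` is the horizontal lift of `γ'`, `V = ∂_z` and
`ξ` is the unit normal of the Hopf cylinder. -/
def frameVec (m l : ℝ) (γ : ℝ → (Fin 2 → ℝ)) (s a b c : ℝ) : Fin 3 → ℝ :=
  ![a * vel γ s 0 + c * vel γ s 1, a * vel γ s 1 - c * vel γ s 0,
    b - a * tilt m l γ s - c * normalTilt m l γ s]

theorem hopfNormal_eq (m l : ℝ) (γ : ℝ → (Fin 2 → ℝ)) (p : Fin 2 → ℝ)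
    (hF : conf m (γ (p 0) 0) (γ (p 0) 1) ≠ 0) :
    hopfNormal m l γ p = frameVec m l γ (p 0) 0 0 1 := by
  funext a
  fin_cases a <;> simp [hopfNormal, frameVec, normalTilt] <;> field_simp
  ring

section

variable {m : ℝ} {γ : ℝ → (Fin 2 → ℝ)} {I : Set ℝ} {p : Fin 2 → ℝ}

theorem dmap_hopfCylinder_zero (h : IsUnitSpeedCurve m γ I) (l : ℝ) (hp : p 0 ∈ I) :
    dmap (hopfCylinder γ) 0 p = frameVec m l γ (p 0) 1 (tilt m l γ (p 0)) 0 := by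
  funext a
  fin_cases a
  · simpa [dmap, hopfCylinder, frameVec] using (hasDerivAt_pd (h.hasDerivAt_apply hp 0) 0).2
  · simpa [dmap, hopfCylinder, frameVec] using (hasDerivAt_pd (h.hasDerivAt_apply hp 1) 0).2
  · simpa [dmap, hopfCylinder, frameVec] using pd_coord (p := p) (i := 0) 1

theorem dmap_hopfCylinder_one (h : IsUnitSpeedCurve m γ I) (l : ℝ) (hp : p 0 ∈ I) :
    dmap (hopfCylinder γ) 1 p = frameVec m l γ (p 0) 0 1 0 := by
  funext a
  fin_cases a
  · simpa [dmap, hopfCylinder, frameVec] using (hasDerivAt_pd (h.hasDerivAt_apply hp 0) 1).2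
  · simpa [dmap, hopfCylinder, frameVec] using (hasDerivAt_pd (h.hasDerivAt_apply hp 1) 1).2
  · simpa [dmap, hopfCylinder, frameVec] using pd_coord (p := p) (i := 1) 1

/-- Orthonormality of X, V, ξ rests on x'² + y'² = F². The third coordinate of `P` is free because
the metric is invariant under vertical translations. -/
theorem ip_frameVec (h : IsUnitSpeedCurve m γ I) (l : ℝ) {s : ℝ} (hs : s ∈ I) {P : Fin 3 → ℝ}
    (h0 : P 0 = γ s 0) (h1 : P 1 = γ s 1) (a b c a' b' c' : ℝ) :
    ip (bcvMetric m l) P (frameVec m l γ s a b c) (frameVec m l γ s a' b' c') =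
      a * a' + b * b' + c * c' := by
  have hF := h.conf_ne_zero s hs
  have hsq := h.sq_add_sq_vel hs
  simp only [ip, bcvMetric_eq, Fin.sum_univ_three, h0, h1]
  simp [frameVec, tilt, normalTilt]
  field_simp
  linear_combination 4 * (a * a' + c * c') * hsq

theorem hasDerivAt_tilt (h : IsUnitSpeedCurve m γ I) (l : ℝ) {s : ℝ} (hs : s ∈ I) :
    HasDerivAt (tilt m l γ) (geodCurv m γ s * normalTilt m l γ s
      + 2 * m * (γ s 0 * vel γ s 0 + γ s 1 * vel γ s 1) / conf m (γ s 0) (γ s 1)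
        * tilt m l γ s) s := by
  have hF := h.conf_ne_zero s hs
  have := ((((h.hasDerivAt_apply hs 1).mul (h.hasDerivAt_vel hs).1).sub
    ((h.hasDerivAt_apply hs 0).mul (h.hasDerivAt_vel hs).2)).const_mul (l / 2)).div
    (h.hasDerivAt_conf hs) hF
  refine this.congr_deriv ?_
  simp only [tilt, normalTilt, Pi.mul_apply, Pi.sub_apply]
  field_simp
  ring

theorem hasDerivAt_normalTilt (h : IsUnitSpeedCurve m γ I) (l : ℝ) {s : ℝ} (hs : s ∈ I) :
    HasDerivAt (normalTilt m l γ) (l / 2 * ((vel γ s 0 ^ 2 + vel γ s 1 ^ 2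
        + 2 * m / conf m (γ s 0) (γ s 1) * ((γ s 0 ^ 2 - γ s 1 ^ 2)
          * (vel γ s 0 ^ 2 - vel γ s 1 ^ 2) + 4 * γ s 0 * γ s 1 * vel γ s 0 * vel γ s 1))
          / conf m (γ s 0) (γ s 1)
        - 2 * m * (γ s 0 * vel γ s 0 + γ s 1 * vel γ s 1) ^ 2 / conf m (γ s 0) (γ s 1) ^ 2)
      - geodCurv m γ s * tilt m l γ s) s := by
  have hF := h.conf_ne_zero s hs
  have := ((((h.hasDerivAt_apply hs 0).mul (h.hasDerivAt_vel hs).1).add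
    ((h.hasDerivAt_apply hs 1).mul (h.hasDerivAt_vel hs).2)).const_mul (l / 2)).div
    (h.hasDerivAt_conf hs) hF
  refine this.congr_deriv ?_
  simp only [tilt, Pi.mul_apply, Pi.add_apply]
  field_simp
  ring

variable {α β υ : (Fin 2 → ℝ) → ℝ}

theorem pd_frameVec (h : IsUnitSpeedCurve m γ I) (l : ℝ) (hp : p 0 ∈ I)
    (hα : DifferentiableAt ℝ α p) (hβ : DifferentiableAt ℝ β p) (hυ : DifferentiableAt ℝ υ p)
    (i : Fin 2) (a : Fin 3) :
    pd i (fun q => frameVec m l γ (q 0) (α q) (β q) (υ q) a) p =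
      frameVec m l γ (p 0) (pd i α p) (pd i β p) (pd i υ p) a
      + if i = 0 then ![α p * deriv (fun t => vel γ t 0) (p 0)
            + υ p * deriv (fun t => vel γ t 1) (p 0),
          α p * deriv (fun t => vel γ t 1) (p 0) - υ p * deriv (fun t => vel γ t 0) (p 0),
          -(α p * deriv (tilt m l γ) (p 0)) - υ p * deriv (normalTilt m l γ) (p 0)] a else 0 := by
  obtain ⟨hx, hx'⟩ := hasDerivAt_pd (h.hasDerivAt_vel hp).1.differentiableAt.hasDerivAt i
  obtain ⟨hy, hy'⟩ := hasDerivAt_pd (h.hasDerivAt_vel hp).2.differentiableAt.hasDerivAt i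
  obtain ⟨ht, ht'⟩ := hasDerivAt_pd (hasDerivAt_tilt h l hp).differentiableAt.hasDerivAt i
  obtain ⟨hn, hn'⟩ := hasDerivAt_pd (hasDerivAt_normalTilt h l hp).differentiableAt.hasDerivAt i
  fin_cases a
  · simp only [frameVec, Matrix.cons_val_zero, Fin.zero_eta]
    rw [pd_add (hα.fun_mul hx) (hυ.fun_mul hy), pd_mul hα hx, pd_mul hυ hy, hx', hy']
    split_ifs <;> ring
  · simp only [frameVec, Matrix.cons_val, Matrix.cons_val_one, Fin.mk_one]
    rw [pd_sub (hα.fun_mul hy) (hυ.fun_mul hx), pd_mul hα hy, pd_mul hυ hx, hx', hy']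
    split_ifs <;> ring
  · simp only [frameVec, Matrix.cons_val, Fin.reduceFinMk]
    rw [pd_sub (hβ.fun_sub (hα.fun_mul ht)) (hυ.fun_mul hn), pd_sub hβ (hα.fun_mul ht),
      pd_mul hα ht, pd_mul hυ hn, ht', hn']
    split_ifs <;> ring

/-- The connection matrix of an orthonormal frame is skew. X and V are parallel for the flat induced
metric, so only rotations into ξ survive; their rates are the second fundamental form of X + tV with
X and with V, namely κ + lt/2 and l/2. -/
theorem covAlong_frameVec_zero (h : IsUnitSpeedCurve m γ I) (l : ℝ) (hp : p 0 ∈ I)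
    (hα : DifferentiableAt ℝ α p) (hβ : DifferentiableAt ℝ β p) (hυ : DifferentiableAt ℝ υ p) :
    covAlong (bcvMetric m l) (hopfCylinder γ) 0
      (fun q => frameVec m l γ (q 0) (α q) (β q) (υ q)) p =
      frameVec m l γ (p 0)
        (pd 0 α p - (geodCurv m γ (p 0) + l / 2 * tilt m l γ (p 0)) * υ p)
        (pd 0 β p - l / 2 * υ p)
        (pd 0 υ p + (geodCurv m γ (p 0) + l / 2 * tilt m l γ (p 0)) * α p + l / 2 * β p) := by
  have hF := h.conf_ne_zero _ hp
  have hsq := h.sq_add_sq_vel hp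
  funext a
  have hc : ∀ a b c, christoffel (bcvMetric m l) a b c (hopfCylinder γ p) =
      bcvChristoffel m l (hopfCylinder γ p) a b c :=
    christoffel_bcvMetric m l (hopfCylinder γ p) hF
  simp only [covAlong, pd_frameVec h l hp hα hβ hυ, dmap_hopfCylinder_zero h l hp, hc,
    (h.hasDerivAt_vel hp).1.deriv, (h.hasDerivAt_vel hp).2.deriv,
    (hasDerivAt_tilt h l hp).deriv, (hasDerivAt_normalTilt h l hp).deriv, Fin.sum_univ_three]
  fin_cases a
  · simp [frameVec, bcvChristoffel, hopfCylinder, tilt, normalTilt]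
    field_simp
    ring
  · simp [frameVec, bcvChristoffel, hopfCylinder, tilt, normalTilt]
    field_simp
    ring
  · simp [frameVec, bcvChristoffel, hopfCylinder, tilt, normalTilt]
    field_simp
    -- Of the three components only this vertical one uses F = 1 + m(x² + y²) and the unit speed
    -- relation.
    have hcf : m * (γ (p 0) 0 ^ 2 + γ (p 0) 1 ^ 2) = conf m (γ (p 0) 0) (γ (p 0) 1) - 1 := by
      simp [conf]
    linear_combination 16 * l * υ p * (vel γ (p 0) 0 ^ 2 + vel γ (p 0) 1 ^ 2) * hcf
      - 16 * l * υ p * hsq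

/-- The fibre direction has II(V, X) = l/2 and II(V, V) = 0, the latter because the fibres are
geodesics. -/
theorem covAlong_frameVec_one (h : IsUnitSpeedCurve m γ I) (l : ℝ) (hp : p 0 ∈ I)
    (hα : DifferentiableAt ℝ α p) (hβ : DifferentiableAt ℝ β p) (hυ : DifferentiableAt ℝ υ p) :
    covAlong (bcvMetric m l) (hopfCylinder γ) 1
      (fun q => frameVec m l γ (q 0) (α q) (β q) (υ q)) p =
      frameVec m l γ (p 0) (pd 1 α p - l / 2 * υ p) (pd 1 β p) (pd 1 υ p + l / 2 * α p) := by
  have hF := h.conf_ne_zero _ hp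
  funext a
  have hc : ∀ a b c, christoffel (bcvMetric m l) a b c (hopfCylinder γ p) =
      bcvChristoffel m l (hopfCylinder γ p) a b c :=
    christoffel_bcvMetric m l (hopfCylinder γ p) hF
  simp only [covAlong, pd_frameVec h l hp hα hβ hυ, dmap_hopfCylinder_one h l hp, hc,
    Fin.sum_univ_three]
  fin_cases a <;> simp [frameVec, bcvChristoffel, hopfCylinder, tilt, normalTilt] <;>
    field_simp <;> ring

end

/-! ### Conformal changes of the induced metric -/

theorem isOpen_cylinderDomain {I J : Set ℝ} (hI : IsOpen I) (hJ : IsOpen J) :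
    IsOpen (cylinderDomain I J) :=
  (hI.preimage (continuous_apply 0)).inter (hJ.preimage (continuous_apply 1))

theorem contDiffOn_pd {d : ℕ} {u : (Fin d → ℝ) → ℝ} {U : Set (Fin d → ℝ)} (hU : IsOpen U)
    (hu : ContDiffOn ℝ ∞ u U) (i : Fin d) : ContDiffOn ℝ ∞ (pd i u) U :=
  (hu.fderiv_of_isOpen hU (by simp)).clm_apply contDiffOn_const

/-- The matrix of the flat metric `(1 + t²) ds² + 2 t ds dz + dz²`. -/
def shearMatrix (t : ℝ) : Matrix (Fin 2) (Fin 2) ℝ := !![1 + t ^ 2, t; t, 1]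

theorem inv_smul_shearMatrix_inv {a : ℝ} (ha : a ≠ 0) (t : ℝ) :
    (a⁻¹ • shearMatrix t)⁻¹ = !![a, -(a * t); -(a * t), a * (1 + t ^ 2)] := by
  apply Matrix.inv_eq_right_inv
  ext i j
  fin_cases i <;> fin_cases j <;>
    simp [shearMatrix, Matrix.mul_apply, Fin.sum_univ_two] <;> field_simp <;> ring

/-- The contracted Christoffel symbols of a metric conformal to `(1 + t²) ds² + 2 t ds dz + dz²`
with `t = t(s)`. -/
theorem trace_christoffel_shear {g : (Fin 2 → ℝ) → Matrix (Fin 2) (Fin 2) ℝ}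
    {f : (Fin 2 → ℝ) → ℝ} {t : ℝ → ℝ} {t' : ℝ} {p : Fin 2 → ℝ}
    (hg : g =ᶠ[nhds p] fun q => (f q)⁻¹ • shearMatrix (t (q 0)))
    (hf : DifferentiableAt ℝ f p) (hf0 : f p ≠ 0) (ht : HasDerivAt t t' (p 0)) (k : Fin 2) :
    ∑ i, ∑ j, (g p)⁻¹ i j * christoffel g k i j p = ![0, f p * t'] k := by
  obtain ⟨hT, hT'⟩ := hasDerivAt_pd ht (0 : Fin 2)
  have hT'' := (hasDerivAt_pd ht (1 : Fin 2)).2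
  have hpd : ∀ i j k, pd i (fun q => g q j k) p =
      pd i (fun q => (f q)⁻¹ * shearMatrix (t (q 0)) j k) p := fun i j k =>
    pd_congr (hg.mono fun q hq => by simp [hq])
  have hfi : DifferentiableAt ℝ (fun q => (f q)⁻¹) p := hf.fun_inv hf0
  generalize hTdef : (fun q : Fin 2 → ℝ => t (q 0)) = T at hT hT' hT''
  have hTq : ∀ q : Fin 2 → ℝ, t (q 0) = T q := fun q => by rw [← hTdef]
  have hentry : ∀ i j k, pd i (fun q => (f q)⁻¹ * shearMatrix (T q) j k) p =
      -pd i f p / f p ^ 2 * shearMatrix (T p) j k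
        + (f p)⁻¹ * (!![2 * T p * pd i T p, pd i T p; pd i T p, 0] j k) := by
    intro i j k
    have h₁ : DifferentiableAt ℝ (fun q => 1 + T q ^ 2) p := by fun_prop
    have h₂ : DifferentiableAt ℝ (fun q => T q ^ 2) p := by fun_prop
    have h₃ : DifferentiableAt ℝ (fun _ : Fin 2 → ℝ => (1 : ℝ)) p := by fun_prop
    fin_cases j <;> fin_cases k <;>
      simp only [shearMatrix, Matrix.of_apply, Matrix.cons_val', Matrix.cons_val_zero,
        Matrix.cons_val_one, Fin.zero_eta, Fin.mk_one,
        Matrix.cons_val_fin_one]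
    · rw [pd_mul hfi h₁, pd_inv hf hf0, pd_add h₃ h₂, pd_pow_two hT, pd_const]; ring
    · rw [pd_mul hfi hT, pd_inv hf hf0]; ring
    · rw [pd_mul hfi hT, pd_inv hf hf0]; ring
    · rw [pd_mul hfi h₃, pd_inv hf hf0, pd_const]; ring
  simp only [christoffel, hpd, hTq, hentry, hg.eq_of_nhds, inv_smul_shearMatrix_inv hf0,
    Fin.sum_univ_two, hT', hT'']
  fin_cases k <;> simp [shearMatrix] <;> field_simp <;> ring

section

variable {m : ℝ} {γ : ℝ → (Fin 2 → ℝ)} {I : Set ℝ} {p : Fin 2 → ℝ}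

theorem pullbackMetric_hopfCylinder (h : IsUnitSpeedCurve m γ I) (l : ℝ) (hp : p 0 ∈ I) :
    pullbackMetric (bcvMetric m l) (hopfCylinder γ) p = shearMatrix (tilt m l γ (p 0)) := by
  have key := ip_frameVec h l hp (P := hopfCylinder γ p) rfl rfl
  ext i j
  fin_cases i <;> fin_cases j <;>
    simp [pullbackMetric, dmap_hopfCylinder_zero h l hp, dmap_hopfCylinder_one h l hp, key,
      shearMatrix, pow_two]

theorem frameVec_apply (m l : ℝ) (γ : ℝ → (Fin 2 → ℝ)) (s a b c : ℝ) (k : Fin 3) :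
    frameVec m l γ s a b c k = a * frameVec m l γ s 1 0 0 k + b * frameVec m l γ s 0 1 0 k
      + c * frameVec m l γ s 0 0 1 k := by
  fin_cases k <;> simp [frameVec]
  all_goals ring

theorem frameVec_eq_zero (h : IsUnitSpeedCurve m γ I) (l : ℝ) {s : ℝ} (hs : s ∈ I)
    {a b c : ℝ} (h0 : frameVec m l γ s a b c = 0) : a = 0 ∧ b = 0 ∧ c = 0 := by
  have key := ip_frameVec h l hs (P := ![γ s 0, γ s 1, 0]) rfl rfl a b c a b c
  rw [h0] at key
  simp [ip] at key
  have := mul_self_nonneg a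
  have := mul_self_nonneg b
  have := mul_self_nonneg c
  refine ⟨?_, ?_, ?_⟩ <;> apply mul_self_eq_zero.1 <;> linarith

theorem covAlong_dmap (h : IsUnitSpeedCurve m γ I) (l : ℝ) (hp : p 0 ∈ I) :
    covAlong (bcvMetric m l) (hopfCylinder γ) 0 (dmap (hopfCylinder γ) 0) p =
      frameVec m l γ (p 0) 0 (deriv (tilt m l γ) (p 0))
        (geodCurv m γ (p 0) + l * tilt m l γ (p 0)) ∧
    covAlong (bcvMetric m l) (hopfCylinder γ) 0 (dmap (hopfCylinder γ) 1) p =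
      frameVec m l γ (p 0) 0 0 (l / 2) ∧
    covAlong (bcvMetric m l) (hopfCylinder γ) 1 (dmap (hopfCylinder γ) 0) p =
      frameVec m l γ (p 0) 0 0 (l / 2) ∧
    covAlong (bcvMetric m l) (hopfCylinder γ) 1 (dmap (hopfCylinder γ) 1) p =
      frameVec m l γ (p 0) 0 0 0 := by
  have hev : ∀ᶠ q in nhds p, q 0 ∈ I :=
    (h.isOpen.preimage (continuous_apply 0)).mem_nhds hp
  have e₀ : dmap (hopfCylinder γ) 0 =ᶠ[nhds p] fun q =>
      frameVec m l γ (q 0) ((fun _ => 1) q) ((fun q => tilt m l γ (q 0)) q) ((fun _ => 0) q) :=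
    hev.mono fun q hq => dmap_hopfCylinder_zero h l hq
  have e₁ : dmap (hopfCylinder γ) 1 =ᶠ[nhds p] fun q =>
      frameVec m l γ (q 0) ((fun _ => 0) q) ((fun _ => 1) q) ((fun _ => 0) q) :=
    hev.mono fun q hq => dmap_hopfCylinder_one h l hq
  have ht := hasDerivAt_pd (hasDerivAt_tilt h l hp).differentiableAt.hasDerivAt
  rw [covAlong_congr e₀, covAlong_congr e₁, covAlong_congr e₀, covAlong_congr e₁,
    covAlong_frameVec_zero h l hp (by fun_prop) (ht 0).1 (by fun_prop),
    covAlong_frameVec_zero h l hp (by fun_prop) (by fun_prop) (by fun_prop),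
    covAlong_frameVec_one h l hp (by fun_prop) (ht 0).1 (by fun_prop),
    covAlong_frameVec_one h l hp (by fun_prop) (by fun_prop) (by fun_prop)]
  simp only [pd_const, (ht 0).2, (ht 1).2]
  refine ⟨?_, ?_, ?_, ?_⟩ <;> congr 1 <;> simp
  ring

/-- The inverse metric has entries 1, -t, 1 + t², so the trace of the second fundamental form is (κ
+ lt) - 2t(l/2) = κ. -/
theorem meanCurvature_hopfCylinder (h : IsUnitSpeedCurve m γ I) (l : ℝ) (hp : p 0 ∈ I) :
    meanCurvature (bcvMetric m l) (hopfCylinder γ) (hopfNormal m l γ) p =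
      geodCurv m γ (p 0) / 2 := by
  have key := ip_frameVec h l hp (P := hopfCylinder γ p) rfl rfl
  obtain ⟨h₀₀, h₀₁, h₁₀, h₁₁⟩ := covAlong_dmap h l hp
  have hinv := inv_smul_shearMatrix_inv one_ne_zero (tilt m l γ (p 0))
  rw [inv_one, one_smul] at hinv
  rw [meanCurvature, pullbackMetric_hopfCylinder h l hp, hinv,
    hopfNormal_eq m l γ p (h.conf_ne_zero _ hp)]
  simp only [Fin.sum_univ_two, h₀₀, h₀₁, h₁₀, h₁₁, key]
  simp
  ring

/-- The curvature operator of the BCV space. -/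
theorem curvatureOp_bcvMetric (m l : ℝ) (P : Fin 3 → ℝ) (hF : conf m (P 0) (P 1) ≠ 0)
    (X Y Z : Fin 3 → ℝ) (a : Fin 3) :
    curvatureOp (bcvMetric m l) P X Y Z a =
      (4 * m - 3 * l ^ 2 / 4) * (ip (bcvMetric m l) P Y Z * X a - ip (bcvMetric m l) P X Z * Y a)
      - (4 * m - l ^ 2) * ((contactForm m l P ⬝ᵥ Y) * (contactForm m l P ⬝ᵥ Z) * X a
        - (contactForm m l P ⬝ᵥ X) * (contactForm m l P ⬝ᵥ Z) * Y a
        + (ip (bcvMetric m l) P Y Z * (contactForm m l P ⬝ᵥ X)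
          - ip (bcvMetric m l) P X Z * (contactForm m l P ⬝ᵥ Y)) * if a = 2 then 1 else 0) := by
  simp only [curvatureOp, curvature_bcvMetric m l P hF, bcvCurvature, ip, dotProduct,
    Fin.sum_univ_three]
  generalize bcvMetric m l P = h
  generalize contactForm m l P = η
  fin_cases a <;> simp <;> ring

theorem contactForm_frameVec (h : IsUnitSpeedCurve m γ I) (l : ℝ) (hp : p 0 ∈ I) (a b c : ℝ) :
    contactForm m l (hopfCylinder γ p) ⬝ᵥ frameVec m l γ (p 0) a b c = b := by
  have hF := h.conf_ne_zero _ hp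
  simp [contactForm, dotProduct, Fin.sum_univ_three, frameVec, hopfCylinder, tilt, normalTilt]
  field_simp
  ring

end

/-! ### The tension and bitension fields of a conformally rescaled Hopf cylinder -/

section Bitension

variable {m : ℝ} {γ : ℝ → (Fin 2 → ℝ)} {I J : Set ℝ} {p : Fin 2 → ℝ} {f : (Fin 2 → ℝ) → ℝ}

/-- The metric `f⁻¹ φ^*h` on the Hopf cylinder `φ`. -/
def rescaledMetric (m l : ℝ) (γ : ℝ → (Fin 2 → ℝ)) (f : (Fin 2 → ℝ) → ℝ) (p : Fin 2 → ℝ) :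
    Matrix (Fin 2) (Fin 2) ℝ :=
  (f p)⁻¹ • pullbackMetric (bcvMetric m l) (hopfCylinder γ) p

theorem rescaledMetric_eventuallyEq (h : IsUnitSpeedCurve m γ I) (l : ℝ) (hp : p 0 ∈ I) :
    rescaledMetric m l γ f =ᶠ[nhds p] fun q => (f q)⁻¹ • shearMatrix (tilt m l γ (q 0)) := by
  filter_upwards [(h.isOpen.preimage (continuous_apply 0)).mem_nhds hp] with q hq
  rw [rescaledMetric, pullbackMetric_hopfCylinder h l hq]

theorem exists_frameVec_apply (m l : ℝ) (γ : ℝ → (Fin 2 → ℝ)) (s : ℝ) (k : Fin 3) :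
    ∃ e₁ e₂ e₃ : ℝ, ∀ a b c, frameVec m l γ s a b c k = a * e₁ + b * e₂ + c * e₃ :=
  ⟨_, _, _, fun a b c => frameVec_apply m l γ s a b c k⟩

/-- In dimension two the derivatives of the conformal factor cancel from the contracted Christoffel
symbols. What remains of them removes the tangential term t'V, leaving f times the trace κ. -/
theorem tension_hopfCylinder (h : IsUnitSpeedCurve m γ I) (l : ℝ) (hp : p 0 ∈ I)
    (hf : DifferentiableAt ℝ f p) (hf0 : f p ≠ 0) :
    tension (rescaledMetric m l γ f) (bcvMetric m l) (hopfCylinder γ) p =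
      frameVec m l γ (p 0) 0 0 (f p * geodCurv m γ (p 0)) := by
  have hg := rescaledMetric_eventuallyEq (f := f) h l hp
  have htr := trace_christoffel_shear hg hf hf0 (hasDerivAt_tilt h l hp)
  rw [← (hasDerivAt_tilt h l hp).deriv] at htr
  have h0 := htr 0
  have h1 := htr 1
  obtain ⟨h₀₀, h₀₁, h₁₀, h₁₁⟩ := covAlong_dmap h l hp
  have hinv : (rescaledMetric m l γ f p)⁻¹ = _ :=
    (congrArg _ hg.eq_of_nhds).trans (inv_smul_shearMatrix_inv hf0 (tilt m l γ (p 0)))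
  funext a
  simp only [tension, Fin.sum_univ_two, h₀₀, h₀₁, h₁₀, h₁₁, dmap_hopfCylinder_zero h l hp,
    dmap_hopfCylinder_one h l hp, hinv] at h0 h1 ⊢
  obtain ⟨e₁, e₂, e₃, hlin⟩ := exists_frameVec_apply m l γ (p 0) a
  simp only [hlin]
  simp at h0 h1 ⊢
  linear_combination -(e₁ + tilt m l γ (p 0) * e₂) * h0 - e₂ * h1

/-- Apply the two covariant derivatives of the frame twice to uξ. In the normal part, the
zeroth-order coefficient combines |A|² = κ² + l²/2 with Ric(ξ, ξ) = 4m - l²/2. -/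
theorem bitension_hopfCylinder (h : IsUnitSpeedCurve m γ I) (l : ℝ) (hJ : IsOpen J)
    (hf : ContDiffOn ℝ ∞ f (cylinderDomain I J)) (hf0 : ∀ p ∈ cylinderDomain I J, f p ≠ 0)
    (hp : p ∈ cylinderDomain I J) {u : (Fin 2 → ℝ) → ℝ}
    (hu : u = fun q => f q * geodCurv m γ (q 0)) :
    bitension (rescaledMetric m l γ f) (bcvMetric m l) (hopfCylinder γ) p =
      frameVec m l γ (p 0)
        (-f p * (2 * geodCurv m γ (p 0) * (pd 0 u p - tilt m l γ (p 0) * pd 1 u p)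
          + l * pd 1 u p + deriv (geodCurv m γ) (p 0) * u p))
        (-f p * (l * (pd 0 u p - tilt m l γ (p 0) * pd 1 u p)))
        (f p * (pd 0 (pd 0 u) p - tilt m l γ (p 0) * (pd 0 (pd 1 u) p + pd 1 (pd 0 u) p)
          + (1 + tilt m l γ (p 0) ^ 2) * pd 1 (pd 1 u) p
          - deriv (tilt m l γ) (p 0) * pd 1 u p
          - (geodCurv m γ (p 0) ^ 2 + l ^ 2 - 4 * m) * u p)) := by
  have hp0 : p 0 ∈ I := hp.1
  have hU := isOpen_cylinderDomain h.isOpen hJ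
  have hκ := h.contDiffOn_geodCurv
  have hus : ContDiffOn ℝ ∞ u (cylinderDomain I J) := by
    rw [hu]
    exact hf.mul (hκ.comp (contDiff_apply ℝ ℝ (0 : Fin 2)).contDiffOn fun q hq => hq.1)
  have hdiff : ∀ {v : (Fin 2 → ℝ) → ℝ}, ContDiffOn ℝ ∞ v (cylinderDomain I J) →
      ∀ q ∈ cylinderDomain I J, DifferentiableAt ℝ v q := fun hv q hq =>
    (hv.contDiffAt (hU.mem_nhds hq)).differentiableAt (by simp)
  have hκd : HasDerivAt (geodCurv m γ) (deriv (geodCurv m γ) (p 0)) (p 0) :=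
    ((hκ.contDiffAt (h.isOpen.mem_nhds hp0)).differentiableAt (by simp)).hasDerivAt
  have htd := (hasDerivAt_tilt h l hp0).differentiableAt.hasDerivAt
  have hκp := hasDerivAt_pd hκd
  have htp := hasDerivAt_pd htd
  have hdu := hdiff hus
  have hdu0 := hdiff (contDiffOn_pd hU hus 0)
  have hdu1 := hdiff (contDiffOn_pd hU hus 1)
  have eτ : ∀ q ∈ cylinderDomain I J,
      tension (rescaledMetric m l γ f) (bcvMetric m l) (hopfCylinder γ) =ᶠ[nhds q] fun q =>
        frameVec m l γ (q 0) ((fun _ => 0) q) ((fun _ => 0) q) (u q) := by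
    intro q hq
    filter_upwards [hU.mem_nhds hq] with r hr
    rw [tension_hopfCylinder h l hr.1 (hdiff hf r hr) (hf0 r hr), hu]
  have hW₀ : ∀ q ∈ cylinderDomain I J, covAlong (bcvMetric m l) (hopfCylinder γ) 0
      (tension (rescaledMetric m l γ f) (bcvMetric m l) (hopfCylinder γ)) q =
        frameVec m l γ (q 0)
          ((fun q => -((geodCurv m γ (q 0) + l / 2 * tilt m l γ (q 0)) * u q)) q)
          ((fun q => -(l / 2 * u q)) q) (pd 0 u q) := by
    intro q hq
    rw [covAlong_congr (eτ q hq), covAlong_frameVec_zero h l hq.1 (by fun_prop) (by fun_prop)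
      (hdu q hq)]
    simp [pd_const]
  have hW₁ : ∀ q ∈ cylinderDomain I J, covAlong (bcvMetric m l) (hopfCylinder γ) 1
      (tension (rescaledMetric m l γ f) (bcvMetric m l) (hopfCylinder γ)) q =
        frameVec m l γ (q 0) ((fun q => -(l / 2 * u q)) q) ((fun _ => 0) q) (pd 1 u q) := by
    intro q hq
    rw [covAlong_congr (eτ q hq), covAlong_frameVec_one h l hq.1 (by fun_prop) (by fun_prop)
      (hdu q hq)]
    simp [pd_const]
  have eW₀ := Filter.eventuallyEq_of_mem (hU.mem_nhds hp) hW₀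
  have eW₁ := Filter.eventuallyEq_of_mem (hU.mem_nhds hp) hW₁
  have hup := hdu p hp
  have hc : DifferentiableAt ℝ (fun _ : Fin 2 → ℝ => l / 2) p := by fun_prop
  have hcu : DifferentiableAt ℝ (fun q => -(l / 2 * u q)) p := by fun_prop
  have hct := hc.fun_mul (htp 0).1
  have hsum := (hκp 0).1.fun_add hct
  have hα : DifferentiableAt ℝ
      (fun q => -((geodCurv m γ (q 0) + l / 2 * tilt m l γ (q 0)) * u q)) p :=
    (hsum.fun_mul hup).fun_neg
  have hpcu : ∀ i, pd i (fun q => -(l / 2 * u q)) p = -(l / 2 * pd i u p) := by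
    intro i
    rw [pd_neg, pd_mul hc hup, pd_const]; ring
  have hpα : ∀ i, pd i
      (fun q => -((geodCurv m γ (q 0) + l / 2 * tilt m l γ (q 0)) * u q)) p =
      -((geodCurv m γ (p 0) + l / 2 * tilt m l γ (p 0)) * pd i u p
        + (if i = 0 then deriv (geodCurv m γ) (p 0) + l / 2 * deriv (tilt m l γ) (p 0) else 0)
          * u p) := by
    intro i
    rw [pd_neg, pd_mul hsum hup, pd_add (hκp 0).1 hct, pd_mul hc (htp 0).1, pd_const,
      (hκp i).2, (htp i).2]
    split_ifs <;> ring
  have hg := rescaledMetric_eventuallyEq (f := f) h l hp0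
  have htr := trace_christoffel_shear hg (hdiff hf p hp) (hf0 p hp) htd
  have h0 := htr 0
  have h1 := htr 1
  have hinv : (rescaledMetric m l γ f p)⁻¹ = _ :=
    (congrArg _ hg.eq_of_nhds).trans (inv_smul_shearMatrix_inv (hf0 p hp) (tilt m l γ (p 0)))
  have hip := ip_frameVec h l hp0 (P := hopfCylinder γ p) rfl rfl
  have hτ := tension_hopfCylinder h l hp0 (hdiff hf p hp) (hf0 p hp)
  rw [show f p * geodCurv m γ (p 0) = u p by rw [hu]] at hτ
  funext a
  simp only [bitension, Fin.sum_univ_two, covAlong_congr eW₀, covAlong_congr eW₁,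
    covAlong_frameVec_zero h l hp0 hα hcu (hdu0 p hp),
    covAlong_frameVec_zero h l hp0 hcu (by fun_prop : DifferentiableAt ℝ (fun _ => (0 : ℝ)) p)
      (hdu1 p hp),
    covAlong_frameVec_one h l hp0 hα hcu (hdu0 p hp),
    covAlong_frameVec_one h l hp0 hcu (by fun_prop : DifferentiableAt ℝ (fun _ => (0 : ℝ)) p)
      (hdu1 p hp), hpα, hpcu, pd_const, hW₀ p hp, hW₁ p hp, hτ,
    curvatureOp_bcvMetric m l (hopfCylinder γ p) (h.conf_ne_zero _ hp0),
    dmap_hopfCylinder_zero h l hp0, dmap_hopfCylinder_one h l hp0, hip,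
    contactForm_frameVec h l hp0, hinv] at h0 h1 ⊢
  obtain ⟨e₁, e₂, e₃, hlin⟩ := exists_frameVec_apply m l γ (p 0) a
  simp only [hlin]
  simp at h0 h1 ⊢
  -- `h0` and `h1` evaluate the contracted Christoffel symbols; they are weighted by the frame
  -- components of the derivatives of τ(φ) along ∂_s and ∂_z.
  linear_combination
    -(-((geodCurv m γ (p 0) + l / 2 * tilt m l γ (p 0)) * u p) * e₁ - l / 2 * u p * e₂
      + pd 0 u p * e₃) * h0 - (-(l / 2 * u p) * e₁ + pd 1 u p * e₃) * h1

end Bitension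

/-! ### Linear and Ermakov ordinary differential equations -/

theorem eq_of_hasDerivAt_zero {J : Set ℝ} (hJ : IsOpen J) (hJ' : J.OrdConnected) {g : ℝ → ℝ}
    (hg : ∀ z ∈ J, HasDerivAt g 0 z) {z w : ℝ} (hz : z ∈ J) (hw : w ∈ J) : g z = g w :=
  hJ.is_const_of_deriv_eq_zero hJ'.isPreconnected
    (fun x hx => (hg x hx).differentiableAt.differentiableWithinAt)
    (fun x hx => (hg x hx).deriv) hz hw

section LinearODE

variable {J : Set ℝ} (hJ : IsOpen J) (hJ' : J.OrdConnected) {K : ℝ} {y y' : ℝ → ℝ}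
  (hy : ∀ z ∈ J, HasDerivAt y (y' z) z) (hy' : ∀ z ∈ J, HasDerivAt y' (K * y z) z)

include hJ hJ' hy hy'

/-- With ρ = √K the operator D² - K factors as (D - ρ)(D + ρ), so (y' + ρy)e^(-ρz) and (y' -
ρy)e^(ρz) are constant. The formula for y' is kept because first integrals are evaluated with it
later. -/
theorem hyperbolic_solution (hne : J.Nonempty) (hK : 0 < K) :
    ∃ a b : ℝ, ∀ z ∈ J, y z = a * Real.exp (√K * z) + b * Real.exp (-(√K * z)) ∧
      y' z = √K * (a * Real.exp (√K * z) - b * Real.exp (-(√K * z))) := by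
  obtain ⟨z₀, hz₀⟩ := hne
  have hρ : √K ≠ 0 := (Real.sqrt_pos.2 hK).ne'
  have hρ2 : √K ^ 2 = K := Real.sq_sqrt hK.le
  set ρ := √K
  have hlin : ∀ z : ℝ, HasDerivAt (fun z => ρ * z) ρ z := fun z => by
    simpa using (hasDerivAt_id z).const_mul ρ
  have hA : ∀ z ∈ J, HasDerivAt (fun z => (y' z + ρ * y z) * Real.exp (-(ρ * z))) 0 z := by
    intro z hz
    refine (((hy' z hz).add ((hy z hz).const_mul ρ)).mul (hlin z).neg.exp).congr_deriv ?_
    simp only [Pi.add_apply]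
    linear_combination -(y z * Real.exp (-(ρ * z))) * hρ2
  have hB : ∀ z ∈ J, HasDerivAt (fun z => (y' z - ρ * y z) * Real.exp (ρ * z)) 0 z := by
    intro z hz
    refine (((hy' z hz).sub ((hy z hz).const_mul ρ)).mul (hlin z).exp).congr_deriv ?_
    simp only [Pi.sub_apply]
    linear_combination -(y z * Real.exp (ρ * z)) * hρ2
  refine ⟨(y' z₀ + ρ * y z₀) * Real.exp (-(ρ * z₀)) / (2 * ρ),
    -((y' z₀ - ρ * y z₀) * Real.exp (ρ * z₀)) / (2 * ρ), fun z hz => ?_⟩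
  have h₁ := eq_of_hasDerivAt_zero hJ hJ' hA hz hz₀
  have h₂ := eq_of_hasDerivAt_zero hJ hJ' hB hz hz₀
  rw [← h₁, ← h₂]
  have he : Real.exp (-(ρ * z)) * Real.exp (ρ * z) = 1 := by rw [← Real.exp_add]; simp
  constructor
  · field_simp
    linear_combination -(2 * ρ * y z) * he
  · field_simp
    linear_combination -2 * y' z * he

/-- Rotating the phase vector (ρy, y') through the angle ρz makes it constant. -/
theorem trigonometric_solution (hne : J.Nonempty) (hK : K < 0) :
    ∃ a b : ℝ, ∀ z ∈ J, y z = a * Real.sin (√(-K) * z) + b * Real.cos (√(-K) * z) ∧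
      y' z = √(-K) * (a * Real.cos (√(-K) * z) - b * Real.sin (√(-K) * z)) := by
  obtain ⟨z₀, hz₀⟩ := hne
  have hρ : √(-K) ≠ 0 := (Real.sqrt_pos.2 (neg_pos.2 hK)).ne'
  have hρ2 : √(-K) ^ 2 = -K := Real.sq_sqrt (neg_pos.2 hK).le
  set ρ := √(-K)
  have hlin : ∀ z : ℝ, HasDerivAt (fun z => ρ * z) ρ z := fun z => by
    simpa using (hasDerivAt_id z).const_mul ρ
  have hA : ∀ z ∈ J, HasDerivAt
      (fun z => ρ * y z * Real.sin (ρ * z) + y' z * Real.cos (ρ * z)) 0 z := by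
    intro z hz
    refine ((((hy z hz).const_mul ρ).mul (hlin z).sin).add
      ((hy' z hz).mul (hlin z).cos)).congr_deriv ?_
    linear_combination y z * Real.cos (ρ * z) * hρ2
  have hB : ∀ z ∈ J, HasDerivAt
      (fun z => ρ * y z * Real.cos (ρ * z) - y' z * Real.sin (ρ * z)) 0 z := by
    intro z hz
    refine ((((hy z hz).const_mul ρ).mul (hlin z).cos).sub
      ((hy' z hz).mul (hlin z).sin)).congr_deriv ?_
    linear_combination -(y z * Real.sin (ρ * z)) * hρ2
  refine ⟨(ρ * y z₀ * Real.sin (ρ * z₀) + y' z₀ * Real.cos (ρ * z₀)) / ρ,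
    (ρ * y z₀ * Real.cos (ρ * z₀) - y' z₀ * Real.sin (ρ * z₀)) / ρ, fun z hz => ?_⟩
  have h₁ := eq_of_hasDerivAt_zero hJ hJ' hA hz hz₀
  have h₂ := eq_of_hasDerivAt_zero hJ hJ' hB hz hz₀
  rw [← h₁, ← h₂]
  have he := Real.sin_sq_add_cos_sq (ρ * z)
  constructor
  · field_simp
    linear_combination -(ρ * y z) * he
  · field_simp
    linear_combination -(y' z) * he

theorem affine_solution (hne : J.Nonempty) (hK : K = 0) :
    ∃ a b : ℝ, ∀ z ∈ J, y z = a * z + b ∧ y' z = a := by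
  obtain ⟨z₀, hz₀⟩ := hne
  subst hK
  have hA : ∀ z ∈ J, HasDerivAt y' 0 z := fun z hz => by simpa using hy' z hz
  have hB : ∀ z ∈ J, HasDerivAt (fun z => y z - y' z * z) 0 z := by
    intro z hz
    refine ((hy z hz).sub ((hA z hz).mul (hasDerivAt_id z))).congr_deriv ?_
    simp
  refine ⟨y' z₀, y z₀ - y' z₀ * z₀, fun z hz => ?_⟩
  have h₁ := eq_of_hasDerivAt_zero hJ hJ' hA hz hz₀
  have h₂ := eq_of_hasDerivAt_zero hJ hJ' hB hz hz₀
  refine ⟨?_, h₁⟩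
  rw [← h₂, ← h₁]; ring

theorem isFibreSolution_of_ode (hne : J.Nonempty) : IsFibreSolution K J y := by
  rcases lt_trichotomy K 0 with hK | hK | hK
  · obtain ⟨a, b, h⟩ := trigonometric_solution hJ hJ' hy hy' hne hK
    exact Or.inl ⟨hK, a, b, fun z hz => (h z hz).1⟩
  · obtain ⟨a, b, h⟩ := affine_solution hJ hJ' hy hy' hne hK
    exact Or.inr (Or.inl ⟨hK, a, b, fun z hz => (h z hz).1⟩)
  · obtain ⟨a, b, h⟩ := hyperbolic_solution hJ hJ' hy hy' hne hK
    exact Or.inr (Or.inr ⟨hK, a, b, fun z hz => (h z hz).1⟩)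

end LinearODE

/-- For Q = 4m + K ≠ 0 the shift v - e/(2Q) solves the homogeneous equation y'' = -4Qy, and for Q =
0 the function v is quadratic. The first integral `hsq` then ties e to the two integration
constants, which produces the square roots in the table. -/
theorem isCurvatureSolution_one_div {I : Set ℝ} (hI : IsOpen I) (hI' : I.OrdConnected)
    (hne : I.Nonempty) {m K e : ℝ} {v v' : ℝ → ℝ} (hpos : ∀ s ∈ I, 0 < v s)
    (hv : ∀ s ∈ I, HasDerivAt v (v' s) s)
    (hv' : ∀ s ∈ I, HasDerivAt v' (2 * e - 4 * (4 * m + K) * v s) s)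
    (hsq : ∀ s ∈ I, v' s ^ 2 = 4 * e * v s - 4 - 4 * (4 * m + K) * v s ^ 2) :
    IsCurvatureSolution m K I (fun s => 1 / v s) := by
  obtain ⟨s₀, hs₀⟩ := id hne
  unfold IsCurvatureSolution
  generalize 4 * m + K = Q at hv' hsq ⊢
  -- By the first integral 4ev = v'² + 4 + 4Qv² > 0, so e is positive. For Q < 0 its sign is
  -- undetermined, whence the ε in that case only.
  have hepos : 0 ≤ Q → 0 < e := by
    intro hQ
    have h₁ := hpos s₀ hs₀
    have h₂ := hsq s₀ hs₀
    by_contra hcon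
    nlinarith [sq_nonneg (v' s₀), mul_nonneg hQ (sq_nonneg (v s₀)),
      mul_nonneg (not_lt.1 hcon |> neg_nonneg.2) h₁.le]
  have hcent : Q ≠ 0 → (∀ s ∈ I, HasDerivAt (fun s => v s - e / (2 * Q)) (v' s) s) ∧
      ∀ s ∈ I, HasDerivAt v' (-(4 * Q) * (v s - e / (2 * Q))) s := by
    intro hQ
    refine ⟨fun s hs => (hv s hs).sub_const _, fun s hs => (hv' s hs).congr_deriv ?_⟩
    field_simp
    ring
  rcases lt_trichotomy Q 0 with hQ | hQ | hQ
  · obtain ⟨h₁, h₂⟩ := hcent hQ.ne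
    obtain ⟨C, D, h⟩ := hyperbolic_solution hI hI' h₁ h₂ hne (by linarith)
    have hr : √(-(4 * Q)) = 2 * √(-Q) := by
      rw [show -(4 * Q) = 2 ^ 2 * -Q by ring, Real.sqrt_mul (by norm_num),
        Real.sqrt_sq (by norm_num)]
    have hr2 : √(-Q) ^ 2 = -Q := Real.sq_sqrt (by linarith)
    rw [hr] at h
    have hCD : 4 * C * D + 1 / Q = (e / (2 * Q)) ^ 2 := by
      obtain ⟨h₃, h₄⟩ := h s₀ hs₀
      have h₅ := hsq s₀ hs₀
      have he : Real.exp (2 * √(-Q) * s₀) * Real.exp (-(2 * √(-Q) * s₀)) = 1 := by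
        rw [← Real.exp_add]; simp
      rw [h₄] at h₅
      have h₆ : v s₀ = C * Real.exp (2 * √(-Q) * s₀) + D * Real.exp (-(2 * √(-Q) * s₀))
          + e / (2 * Q) := by linarith
      rw [h₆] at h₅
      generalize Real.exp (2 * √(-Q) * s₀) = E at he h₅
      generalize Real.exp (-(2 * √(-Q) * s₀)) = G at he h₅
      have hc : e = 2 * Q * (e / (2 * Q)) := by have := hQ.ne; field_simp
      have hq : Q * (1 / Q) = 1 := mul_one_div_cancel hQ.ne
      generalize e / (2 * Q) = c at hc h₅ ⊢
      apply mul_left_cancel₀ (mul_ne_zero four_ne_zero hQ.ne)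
      linear_combination h₅ - 4 * (C * E - D * G) ^ 2 * hr2 - 16 * Q * C * D * he + 4 * hq
        + 4 * (C * E + D * G + c) * hc
    -- ε is the sign of the shift e/(2Q), which the square root recovers only up to sign; at zero
    -- either choice works.
    refine Or.inl ⟨hQ, C, D, if 0 ≤ e / (2 * Q) then 1 else -1, ?_, ?_, fun s hs => ?_⟩
    · split_ifs <;> simp
    · rw [hCD]; positivity
    · rw [hCD, Real.sqrt_sq_eq_abs]
      have h₃ := (h s hs).1
      show 1 / v s = _
      congr 1
      split_ifs with hs
      · rw [abs_of_nonneg hs]; linarith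
      · rw [abs_of_neg (not_le.1 hs)]; linarith
  · subst hQ
    have he := hepos le_rfl
    have h₁ : ∀ s ∈ I, HasDerivAt (fun s => v s - e * s ^ 2) (v' s - 2 * e * s) s := by
      intro s hs
      refine ((hv s hs).sub (((hasDerivAt_id s).pow 2).const_mul e)).congr_deriv ?_
      simp; ring
    have h₂ : ∀ s ∈ I, HasDerivAt (fun s => v' s - 2 * e * s) (0 * (v s - e * s ^ 2)) s := by
      intro s hs
      refine ((hv' s hs).sub ((hasDerivAt_id s).const_mul (2 * e))).congr_deriv ?_
      simp
    obtain ⟨a, b, h⟩ := affine_solution hI hI' h₁ h₂ hne rfl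
    -- Here v = es² + as + b with a² = 4eb - 4; completing the square at -a/(2e) gives these
    -- constants.
    refine Or.inr (Or.inl ⟨rfl, 4 * e, a / (2 * e), fun s hs => ?_⟩)
    have hab : a ^ 2 = 4 * e * b - 4 := by
      obtain ⟨h₃, h₄⟩ := h s₀ hs₀
      have h₅ := hsq s₀ hs₀
      rw [show v' s₀ = a + 2 * e * s₀ by linarith,
        show v s₀ = a * s₀ + b + e * s₀ ^ 2 by linarith] at h₅
      linarith
    have h₃ := (h s hs).1
    rw [div_eq_div_iff (hpos s hs).ne' (by positivity)]
    have h₄ : v s = a * s + b + e * s ^ 2 := by linarith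
    rw [h₄]
    field_simp
    linear_combination 16 * hab
  · obtain ⟨h₁, h₂⟩ := hcent hQ.ne'
    -- The sine coefficient comes first here, while the table lists the cosine coefficient first.
    obtain ⟨D, C, h⟩ := trigonometric_solution hI hI' h₁ h₂ hne (by linarith)
    have hr : √(-(-(4 * Q))) = 2 * √Q := by
      rw [show -(-(4 * Q)) = 2 ^ 2 * Q by ring, Real.sqrt_mul (by norm_num),
        Real.sqrt_sq (by norm_num)]
    have hr2 : √Q ^ 2 = Q := Real.sq_sqrt hQ.le
    rw [hr] at h
    have hCD : 1 / Q + (C ^ 2 + D ^ 2) = (e / (2 * Q)) ^ 2 := by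
      obtain ⟨h₃, h₄⟩ := h s₀ hs₀
      have h₅ := hsq s₀ hs₀
      have he := Real.sin_sq_add_cos_sq (2 * √Q * s₀)
      rw [h₄] at h₅
      have h₆ : v s₀ = D * Real.sin (2 * √Q * s₀) + C * Real.cos (2 * √Q * s₀)
          + e / (2 * Q) := by linarith
      rw [h₆] at h₅
      generalize Real.sin (2 * √Q * s₀) = E at he h₅
      generalize Real.cos (2 * √Q * s₀) = G at he h₅
      have hc : e = 2 * Q * (e / (2 * Q)) := by have := hQ.ne'; field_simp
      have hq : Q * (1 / Q) = 1 := mul_one_div_cancel hQ.ne'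
      generalize e / (2 * Q) = c at hc h₅ ⊢
      apply mul_left_cancel₀ (mul_ne_zero four_ne_zero hQ.ne')
      linear_combination h₅ - 4 * (D * G - C * E) ^ 2 * hr2 - 4 * Q * (C ^ 2 + D ^ 2) * he + 4 * hq
        + 4 * (D * E + C * G + c) * hc
    refine Or.inr (Or.inr ⟨hQ, C, D, fun s hs => ?_⟩)
    have he := hepos hQ.le
    rw [hCD, Real.sqrt_sq (by positivity)]
    have h₃ := (h s hs).1
    show 1 / v s = _
    congr 1
    linarith

/-- A positive solution of `w'' = w⁻³ - (4m + K) w` gives an explicit curvature function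
`w⁻²`. -/
theorem isCurvatureSolution_of_ermakov {I : Set ℝ} (hI : IsOpen I) (hI' : I.OrdConnected)
    (hne : I.Nonempty) {m K : ℝ} {w w' : ℝ → ℝ} (hpos : ∀ s ∈ I, 0 < w s)
    (hw : ∀ s ∈ I, HasDerivAt w (w' s) s)
    (hw' : ∀ s ∈ I, HasDerivAt w' ((w s ^ 3)⁻¹ - (4 * m + K) * w s) s) :
    IsCurvatureSolution m K I (fun s => 1 / w s ^ 2) := by
  obtain ⟨s₀, hs₀⟩ := hne
  -- The conserved energy of the Ermakov equation; with it, v = w² satisfies a linear second-order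
  -- equation.
  have hen : ∀ s ∈ I, HasDerivAt (fun s => w' s ^ 2 + (w s ^ 2)⁻¹ + (4 * m + K) * w s ^ 2) 0 s := by
    intro s hs
    have h0 := (hpos s hs).ne'
    refine ((((hw' s hs).pow 2).add (((hw s hs).pow 2).inv (pow_ne_zero 2 h0))).add
      (((hw s hs).pow 2).const_mul (4 * m + K))).congr_deriv ?_
    simp
    field_simp
    ring
  obtain ⟨e, he⟩ : ∃ e, ∀ s ∈ I, w' s ^ 2 + (w s ^ 2)⁻¹ + (4 * m + K) * w s ^ 2 = e :=
    ⟨_, fun s hs => eq_of_hasDerivAt_zero hI hI' hen hs hs₀⟩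
  have hv : ∀ s ∈ I, HasDerivAt (fun s => w s ^ 2) (2 * w s * w' s) s := fun s hs =>
    ((hw s hs).pow 2).congr_deriv (by simp)
  have hv' : ∀ s ∈ I, HasDerivAt (fun s => 2 * w s * w' s) (2 * e - 4 * (4 * m + K) * w s ^ 2) s := by
    intro s hs
    have h0 := (hpos s hs).ne'
    refine (((hw s hs).const_mul 2).mul (hw' s hs)).congr_deriv ?_
    rw [← he s hs]
    field_simp
    ring
  have hsq : ∀ s ∈ I, (2 * w s * w' s) ^ 2 = 4 * e * w s ^ 2 - 4
      - 4 * (4 * m + K) * (w s ^ 2) ^ 2 := by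
    intro s hs
    have h0 := (hpos s hs).ne'
    rw [← he s hs]
    field_simp
    ring
  exact isCurvatureSolution_one_div hI hI' ⟨s₀, hs₀⟩ (fun s hs => pow_pos (hpos s hs) 2)
    hv hv' hsq

/-! ### The biharmonic equations -/

section BiharmonicEquations

theorem hasDerivAt_slice_zero {u : (Fin 2 → ℝ) → ℝ} {s z : ℝ}
    (hu : DifferentiableAt ℝ u ![s, z]) :
    HasDerivAt (fun t => u ![t, z]) (pd 0 u ![s, z]) s := by
  have h : HasDerivAt (fun t : ℝ => (![t, z] : Fin 2 → ℝ)) (Pi.single 0 1) s := by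
    rw [hasDerivAt_pi]
    intro i
    fin_cases i
    · simpa using hasDerivAt_id' s
    · simpa using hasDerivAt_const s z
  exact hu.hasFDerivAt.comp_hasDerivAt s h

theorem hasDerivAt_slice_one {u : (Fin 2 → ℝ) → ℝ} {s z : ℝ}
    (hu : DifferentiableAt ℝ u ![s, z]) :
    HasDerivAt (fun t => u ![s, t]) (pd 1 u ![s, z]) z := by
  have h : HasDerivAt (fun t : ℝ => (![s, t] : Fin 2 → ℝ)) (Pi.single 1 1) z := by
    rw [hasDerivAt_pi]
    intro i
    fin_cases i
    · simpa using hasDerivAt_const z s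
    · simpa using hasDerivAt_id' z
  exact hu.hasFDerivAt.comp_hasDerivAt z h

theorem pd_comm {d : ℕ} {u : (Fin d → ℝ) → ℝ} {p : Fin d → ℝ} (hu : ContDiffAt ℝ ∞ u p)
    (i j : Fin d) : pd i (pd j u) p = pd j (pd i u) p := by
  have hsymm := hu.isSymmSndFDerivAt (by simpa using WithTop.coe_le_coe.2 (le_top : (2 : ℕ∞) ≤ ⊤))
  have hd : DifferentiableAt ℝ (fderiv ℝ u) p :=
    (hu.fderiv_right (m := ∞) (by simp)).differentiableAt (by simp)
  have key : ∀ i j : Fin d, pd i (pd j u) p =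
      fderiv ℝ (fderiv ℝ u) p (Pi.single i 1) (Pi.single j 1) := by
    intro i j
    have := (hd.hasFDerivAt.clm_apply
      (hasFDerivAt_const (Pi.single j (1 : ℝ) : Fin d → ℝ) p)).fderiv
    unfold pd
    rw [this]
    simp
  rw [key, key, hsymm]

variable {m l : ℝ} {γ : ℝ → (Fin 2 → ℝ)} {I J : Set ℝ} {f : (Fin 2 → ℝ) → ℝ}

theorem contDiffOn_mul_geodCurv (h : IsUnitSpeedCurve m γ I)
    (hf : ContDiffOn ℝ ∞ f (cylinderDomain I J)) :
    ContDiffOn ℝ ∞ (fun q => f q * geodCurv m γ (q 0)) (cylinderDomain I J) :=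
  hf.mul (h.contDiffOn_geodCurv.comp (contDiff_apply ℝ ℝ (0 : Fin 2)).contDiffOn
    fun _ hq => hq.1)

/-- The frame is linearly independent and f > 0, so each coefficient of the bitension field vanishes
separately and the factor f drops out. -/
theorem biharmonic_equations (h : IsUnitSpeedCurve m γ I) (hJ : IsOpen J)
    (hf : ContDiffOn ℝ ∞ f (cylinderDomain I J)) (hfpos : ∀ p ∈ cylinderDomain I J, 0 < f p)
    (hbi : IsBiharmonicMap (cylinderDomain I J) (rescaledMetric m l γ f) (bcvMetric m l)
      (hopfCylinder γ)) {u : (Fin 2 → ℝ) → ℝ} (hu : u = fun q => f q * geodCurv m γ (q 0))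
    {p : Fin 2 → ℝ} (hp : p ∈ cylinderDomain I J) :
    2 * geodCurv m γ (p 0) * (pd 0 u p - tilt m l γ (p 0) * pd 1 u p) + l * pd 1 u p
        + deriv (geodCurv m γ) (p 0) * u p = 0 ∧
      l * (pd 0 u p - tilt m l γ (p 0) * pd 1 u p) = 0 ∧
      pd 0 (pd 0 u) p - tilt m l γ (p 0) * (pd 0 (pd 1 u) p + pd 1 (pd 0 u) p)
          + (1 + tilt m l γ (p 0) ^ 2) * pd 1 (pd 1 u) p
          - deriv (tilt m l γ) (p 0) * pd 1 u p =
        (geodCurv m γ (p 0) ^ 2 + l ^ 2 - 4 * m) * u p := by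
  have hf0 := fun p hp => (hfpos p hp).ne'
  have key := hbi p hp
  rw [bitension_hopfCylinder h l hJ hf hf0 hp hu] at key
  obtain ⟨h₁, h₂, h₃⟩ := frameVec_eq_zero h l hp.1 key
  have h0 := hf0 p hp
  refine ⟨(mul_eq_zero.1 h₁).resolve_left (neg_ne_zero.2 h0),
    (mul_eq_zero.1 h₂).resolve_left (neg_ne_zero.2 h0), ?_⟩
  have := (mul_eq_zero.1 h₃).resolve_left h0
  linarith

theorem exists_geodCurv_ne_zero (h : IsUnitSpeedCurve m γ I) (hJ : IsOpen J)
    (hf : ContDiffOn ℝ ∞ f (cylinderDomain I J)) (hfpos : ∀ p ∈ cylinderDomain I J, 0 < f p)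
    (hnh : ¬ IsHarmonicMap (cylinderDomain I J) (rescaledMetric m l γ f) (bcvMetric m l)
      (hopfCylinder γ)) :
    ∃ s ∈ I, ∃ z ∈ J, geodCurv m γ s ≠ 0 := by
  by_contra! hcon
  refine hnh fun p hp => ?_
  have hU := isOpen_cylinderDomain h.isOpen hJ
  rw [tension_hopfCylinder h l hp.1 ((hf.contDiffAt (hU.mem_nhds hp)).differentiableAt (by simp))
    (hfpos p hp).ne', hcon _ hp.1 _ hp.2]
  funext a
  rw [frameVec_apply]
  simp

theorem hasDerivAt_geodCurv (h : IsUnitSpeedCurve m γ I) {s : ℝ} (hs : s ∈ I) :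
    HasDerivAt (geodCurv m γ) (deriv (geodCurv m γ) s) s :=
  ((h.contDiffOn_geodCurv.contDiffAt (h.isOpen.mem_nhds hs)).differentiableAt
    (by simp)).hasDerivAt

/-- For l ≠ 0 the system is overdetermined: the two tangential equations prescribe both first
derivatives of u, and their compatibility together with the normal equation forces κ and u, hence f,
to be constant. -/
theorem eq_zero_of_proper (h : IsUnitSpeedCurve m γ I) (hI' : I.OrdConnected) (hJ : IsOpen J)
    (hJ' : J.OrdConnected)
    (hf : ContDiffOn ℝ ∞ f (cylinderDomain I J)) (hfpos : ∀ p ∈ cylinderDomain I J, 0 < f p)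
    (hfnonconst : ¬ ∃ c : ℝ, ∀ p ∈ cylinderDomain I J, √(f p) = c)
    (hbi : IsProperBiharmonicMap (cylinderDomain I J) (rescaledMetric m l γ f) (bcvMetric m l)
      (hopfCylinder γ)) : l = 0 := by
  by_contra hl
  obtain ⟨s₀, hs₀, z₀, hz₀, hκ₀⟩ := exists_geodCurv_ne_zero h hJ hf hfpos hbi.2
  have hU := isOpen_cylinderDomain h.isOpen hJ
  have hκd := fun s hs => hasDerivAt_geodCurv (s := s) h hs
  have hκ's : ContDiffOn ℝ ∞ (deriv (geodCurv m γ)) I :=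
    h.contDiffOn_geodCurv.deriv_of_isOpen h.isOpen (by simp)
  have hus := contDiffOn_mul_geodCurv h hf
  obtain ⟨u, hu⟩ : ∃ u : (Fin 2 → ℝ) → ℝ, u = fun q => f q * geodCurv m γ (q 0) := ⟨_, rfl⟩
  rw [← hu] at hus
  have hEq := fun p hp => biharmonic_equations h hJ hf hfpos hbi.1 hu (p := p) hp
  have hudef : ∀ p, u p = f p * geodCurv m γ (p 0) := fun p => congrFun hu p
  set a : ℝ → ℝ := fun s => -deriv (geodCurv m γ) s / l with ha
  have had : ∀ s ∈ I, HasDerivAt a (deriv a s) s := fun s hs =>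
    ((((hκ's.contDiffAt (h.isOpen.mem_nhds hs)).differentiableAt
      (by simp)).fun_neg).div_const l).hasDerivAt
  have hdu : ∀ p ∈ cylinderDomain I J, DifferentiableAt ℝ u p := fun p hp =>
    (hus.contDiffAt (hU.mem_nhds hp)).differentiableAt (by simp)
  have hu0 : ∀ p ∈ cylinderDomain I J, pd 0 u p = tilt m l γ (p 0) * pd 1 u p := fun p hp =>
    sub_eq_zero.1 ((mul_eq_zero.1 (hEq p hp).2.1).resolve_left hl)
  have hu1 : ∀ p ∈ cylinderDomain I J, pd 1 u p = a (p 0) * u p := by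
    intro p hp
    have h₁ := (hEq p hp).1
    rw [hu0 p hp] at h₁
    simp only [ha]
    field_simp
    linarith
  -- The first identity is equality of mixed partials; the second is the normal equation after
  -- substituting u_s = t u_z and u_z = au.
  have key : ∀ p ∈ cylinderDomain I J, deriv a (p 0) * u p = 0 ∧
      a (p 0) ^ 2 * u p = (geodCurv m γ (p 0) ^ 2 + l ^ 2 - 4 * m) * u p := by
    intro p hp
    have hap := hasDerivAt_pd (had (p 0) hp.1)
    have htp := hasDerivAt_pd (hasDerivAt_tilt h l hp.1).differentiableAt.hasDerivAt
    have h₁ : ∀ i, pd i (pd 1 u) p = pd i (fun q => a (q 0) * u q) p := fun i =>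
      pd_congr (Filter.eventuallyEq_of_mem (hU.mem_nhds hp) hu1)
    have h₀ : ∀ i, pd i (pd 0 u) p = pd i (fun q => tilt m l γ (q 0) * pd 1 u q) p := fun i =>
      pd_congr (Filter.eventuallyEq_of_mem (hU.mem_nhds hp) hu0)
    have hd1 : DifferentiableAt ℝ (pd 1 u) p :=
      ((contDiffOn_pd hU hus 1).contDiffAt (hU.mem_nhds hp)).differentiableAt (by simp)
    have hsymm := pd_comm (hus.contDiffAt (hU.mem_nhds hp)) 0 1
    have h₃ := (hEq p hp).2.2
    have e₁ : ∀ i, pd i (pd 1 u) p = a (p 0) * pd i u p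
        + (if i = 0 then deriv a (p 0) else 0) * u p := fun i => by
      rw [h₁, pd_mul (hap i).1 (hdu p hp), (hap i).2]
    have e₀ : ∀ i, pd i (pd 0 u) p = tilt m l γ (p 0) * pd i (pd 1 u) p
        + (if i = 0 then deriv (tilt m l γ) (p 0) else 0) * pd 1 u p := fun i => by
      rw [h₀, pd_mul (htp i).1 hd1, (htp i).2]
    simp only [e₀, e₁, hu0 p hp, hu1 p hp] at h₃ hsymm
    simp at h₃ hsymm
    have h₄ : deriv a (p 0) * u p = 0 := by
      linear_combination hsymm
    exact ⟨h₄, by linear_combination h₃⟩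
  have hune : ∀ s ∈ I, geodCurv m γ s ≠ 0 → u ![s, z₀] ≠ 0 := by
    intro s hs hκ
    rw [hudef]
    exact mul_ne_zero (hfpos _ ⟨hs, hz₀⟩).ne' hκ
  -- Where κ ≠ 0, u can be cancelled nearby; differentiating a² = κ² + l² - 4m with a' = 0 gives κκ'
  -- = 0. Where κ = 0 the product vanishes trivially.
  have hderiv : ∀ s ∈ I, geodCurv m γ s * deriv (geodCurv m γ) s = 0 := by
    intro s hs
    by_cases hκ : geodCurv m γ s = 0
    · simp [hκ]
    have hev : (fun t => a t ^ 2) =ᶠ[nhds s] fun t => geodCurv m γ t ^ 2 + l ^ 2 - 4 * m := by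
      filter_upwards [h.isOpen.mem_nhds hs, (hκd s hs).continuousAt.eventually_ne hκ] with t ht ht'
      exact mul_right_cancel₀ (hune t ht ht') (key ![t, z₀] ⟨ht, hz₀⟩).2
    have ha0 : deriv a s = 0 :=
      (mul_eq_zero.1 (key ![s, z₀] ⟨hs, hz₀⟩).1).resolve_right (hune s hs hκ)
    have h₁ := ((had s hs).fun_pow 2).unique
      ((((hκd s hs).fun_pow 2).add_const (l ^ 2)).sub_const (4 * m) |>.congr_of_eventuallyEq hev)
    rw [ha0] at h₁
    simp at h₁
    rcases h₁ with h₁ | h₁ <;> simp [h₁]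
  -- κ² has derivative 2κκ' = 0 on the interval and is nonzero at s₀.
  have hκne : ∀ s ∈ I, geodCurv m γ s ≠ 0 := by
    intro s hs h0
    have := eq_of_hasDerivAt_zero h.isOpen hI' (g := fun t => geodCurv m γ t ^ 2)
      (fun t ht => ((hκd t ht).fun_pow 2).congr_deriv (by simp [mul_assoc, hderiv t ht])) hs hs₀
    simp only [h0] at this
    exact hκ₀ (by simpa using this.symm)
  have hκ0 : ∀ s ∈ I, deriv (geodCurv m γ) s = 0 := fun s hs =>
    (mul_eq_zero.1 (hderiv s hs)).resolve_left (hκne s hs)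
  have hpdu : ∀ i, ∀ p ∈ cylinderDomain I J, pd i u p = 0 := by
    intro i p hp
    have h₁ : pd 1 u p = 0 := by rw [hu1 p hp]; simp [ha, hκ0 _ hp.1]
    fin_cases i
    · exact (hu0 p hp).trans (by rw [h₁, mul_zero])
    · exact h₁
  have hslice : ∀ s ∈ I, ∀ z ∈ J, u ![s, z] = u ![s₀, z₀] := by
    intro s hs z hz
    have h₁ : u ![s, z] = u ![s₀, z] := eq_of_hasDerivAt_zero h.isOpen hI'
      (g := fun t => u ![t, z]) (fun t ht => by
        simpa [hpdu 0 ![t, z] ⟨ht, hz⟩] using hasDerivAt_slice_zero (hdu ![t, z] ⟨ht, hz⟩)) hs hs₀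
    have h₂ : u ![s₀, z] = u ![s₀, z₀] := eq_of_hasDerivAt_zero hJ hJ'
      (g := fun t => u ![s₀, t]) (fun t ht => by
        simpa [hpdu 1 ![s₀, t] ⟨hs₀, ht⟩] using hasDerivAt_slice_one (hdu ![s₀, t] ⟨hs₀, ht⟩))
        hz hz₀
    exact h₁.trans h₂
  refine hfnonconst ⟨√(f ![s₀, z₀]), fun p hp => ?_⟩
  have hp' : p = ![p 0, p 1] := by ext i; fin_cases i <;> rfl
  have h₁ := hslice (p 0) hp.1 (p 1) hp.2
  rw [hudef, hudef] at h₁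
  have h₂ : geodCurv m γ (p 0) = geodCurv m γ s₀ :=
    eq_of_hasDerivAt_zero h.isOpen hI' (fun t ht => by simpa [hκ0 t ht] using hκd t ht) hp.1 hs₀
  simp only [Matrix.cons_val_zero, h₂] at h₁
  rw [← hp'] at h₁
  rw [mul_right_cancel₀ hκ₀ h₁]

end BiharmonicEquations

/-! ### Separation of variables -/

section Separation

variable {m : ℝ} {γ : ℝ → (Fin 2 → ℝ)} {I J : Set ℝ} {f : (Fin 2 → ℝ) → ℝ}

theorem tilt_zero (m : ℝ) (γ : ℝ → (Fin 2 → ℝ)) : tilt m 0 γ = fun _ => 0 := by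
  funext s
  simp [tilt]

theorem biharmonic_equations_zero (h : IsUnitSpeedCurve m γ I) (hJ : IsOpen J)
    (hf : ContDiffOn ℝ ∞ f (cylinderDomain I J)) (hfpos : ∀ p ∈ cylinderDomain I J, 0 < f p)
    (hbi : IsBiharmonicMap (cylinderDomain I J) (rescaledMetric m 0 γ f) (bcvMetric m 0)
      (hopfCylinder γ)) {u : (Fin 2 → ℝ) → ℝ} (hu : u = fun q => f q * geodCurv m γ (q 0))
    {p : Fin 2 → ℝ} (hp : p ∈ cylinderDomain I J) :
    2 * geodCurv m γ (p 0) * pd 0 u p + deriv (geodCurv m γ) (p 0) * u p = 0 ∧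
      pd 0 (pd 0 u) p + pd 1 (pd 1 u) p = (geodCurv m γ (p 0) ^ 2 - 4 * m) * u p := by
  obtain ⟨h₁, -, h₃⟩ := biharmonic_equations h hJ hf hfpos hbi hu hp
  rw [tilt_zero] at h₁ h₃
  simp at h₁ h₃
  exact ⟨h₁, h₃⟩

/-- Along horizontal lines the function `f² κ³` is constant. -/
theorem sq_mul_geodCurv_cube_eq (h : IsUnitSpeedCurve m γ I) (hI' : I.OrdConnected)
    (hJ : IsOpen J) (hf : ContDiffOn ℝ ∞ f (cylinderDomain I J))
    (hfpos : ∀ p ∈ cylinderDomain I J, 0 < f p)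
    (hbi : IsBiharmonicMap (cylinderDomain I J) (rescaledMetric m 0 γ f) (bcvMetric m 0)
      (hopfCylinder γ)) {s s' z : ℝ} (hs : s ∈ I) (hs' : s' ∈ I) (hz : z ∈ J) :
    f ![s, z] ^ 2 * geodCurv m γ s ^ 3 = f ![s', z] ^ 2 * geodCurv m γ s' ^ 3 := by
  have hU := isOpen_cylinderDomain h.isOpen hJ
  refine eq_of_hasDerivAt_zero h.isOpen hI' (g := fun s => f ![s, z] ^ 2 * geodCurv m γ s ^ 3)
    (fun t ht => ?_) hs hs'
  have hp : ![t, z] ∈ cylinderDomain I J := ⟨ht, hz⟩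
  have hfd := (hf.contDiffAt (hU.mem_nhds hp)).differentiableAt (by simp)
  have hκ := hasDerivAt_geodCurv h ht
  have hκp := hasDerivAt_pd (p := ![t, z]) (j := 0) hκ 0
  obtain ⟨h₁, -⟩ := biharmonic_equations_zero h hJ hf hfpos hbi rfl hp
  rw [pd_mul hfd hκp.1, hκp.2] at h₁
  refine (((hasDerivAt_slice_zero hfd).fun_pow 2).mul (hκ.fun_pow 3)).congr_deriv ?_
  simp at h₁ ⊢
  -- fκ is the integrating factor that turns the X-equation into (f²κ³)_s = 0.
  linear_combination f ![t, z] * geodCurv m γ t * h₁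

/-- f²κ³ is constant in s and f > 0, so a zero of κ would spread to all of I. -/
theorem geodCurv_ne_zero (h : IsUnitSpeedCurve m γ I) (hI' : I.OrdConnected)
    (hJ : IsOpen J) (hf : ContDiffOn ℝ ∞ f (cylinderDomain I J))
    (hfpos : ∀ p ∈ cylinderDomain I J, 0 < f p)
    (hbi : IsBiharmonicMap (cylinderDomain I J) (rescaledMetric m 0 γ f) (bcvMetric m 0)
      (hopfCylinder γ)) {s₀ z₀ : ℝ} (hs₀ : s₀ ∈ I) (hz₀ : z₀ ∈ J) (hκ₀ : geodCurv m γ s₀ ≠ 0)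
    {s : ℝ} (hs : s ∈ I) : geodCurv m γ s ≠ 0 := by
  intro h0
  have := sq_mul_geodCurv_cube_eq h hI' hJ hf hfpos hbi hs hs₀ hz₀
  rw [h0] at this
  have h₁ := (hfpos ![s₀, z₀] ⟨hs₀, hz₀⟩).ne'
  simp [h₁, hκ₀] at this

/-- The conformal factor and the curvature separate: `f = ψ w³` and `|κ| = w⁻²`, where `ψ` solves
a linear and `w` an Ermakov equation with a common separation constant. -/
theorem exists_separation (h : IsUnitSpeedCurve m γ I) (hI' : I.OrdConnected)
    (hJ : IsOpen J) (hf : ContDiffOn ℝ ∞ f (cylinderDomain I J))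
    (hfpos : ∀ p ∈ cylinderDomain I J, 0 < f p)
    (hbi : IsBiharmonicMap (cylinderDomain I J) (rescaledMetric m 0 γ f) (bcvMetric m 0)
      (hopfCylinder γ)) {s₀ z₀ : ℝ} (hs₀ : s₀ ∈ I) (hz₀ : z₀ ∈ J)
    (hκ : ∀ s ∈ I, geodCurv m γ s ≠ 0) :
    ∃ (K : ℝ) (ψ ψ' w w' : ℝ → ℝ),
      (∀ z ∈ J, 0 < ψ z) ∧ (∀ z ∈ J, HasDerivAt ψ (ψ' z) z) ∧
      (∀ z ∈ J, HasDerivAt ψ' (K * ψ z) z) ∧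
      (∀ s, w s = (√|geodCurv m γ s|)⁻¹) ∧ (∀ s ∈ I, HasDerivAt w (w' s) s) ∧
      (∀ s ∈ I, HasDerivAt w' ((w s ^ 3)⁻¹ - (4 * m + K) * w s) s) ∧
      ∀ s ∈ I, ∀ z ∈ J, f ![s, z] = ψ z * w s ^ 3 := by
  have hU := isOpen_cylinderDomain h.isOpen hJ
  have hmem : ∀ {s z}, s ∈ I → z ∈ J → ![s, z] ∈ cylinderDomain I J := fun hs hz => ⟨hs, hz⟩
  set w : ℝ → ℝ := fun s => (√|geodCurv m γ s|)⁻¹ with hw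
  have hrpos : ∀ s ∈ I, 0 < √|geodCurv m γ s| := fun s hs =>
    Real.sqrt_pos.2 (abs_pos.2 (hκ s hs))
  have hwpos : ∀ s ∈ I, 0 < w s := fun s hs => inv_pos.2 (hrpos s hs)
  have hwk : ∀ s ∈ I, w s ^ 2 * |geodCurv m γ s| = 1 := by
    intro s hs
    simp only [hw, inv_pow]
    rw [Real.sq_sqrt (abs_nonneg _)]
    exact inv_mul_cancel₀ (abs_pos.2 (hκ s hs)).ne'
  -- the sign of the curvature
  obtain ⟨σ, hσ, hσκ⟩ : ∃ σ : ℝ, σ ^ 2 = 1 ∧ ∀ s ∈ I, geodCurv m γ s = σ * |geodCurv m γ s| := by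
    have hcube := fun s hs => sq_mul_geodCurv_cube_eq h hI' hJ hf hfpos hbi (s := s) hs hs₀ hz₀
    have hodd : Odd 3 := by decide
    rcases lt_or_gt_of_ne (hκ s₀ hs₀) with hneg | hpos
    · refine ⟨-1, by norm_num, fun s hs => ?_⟩
      have h₁ : f ![s, z₀] ^ 2 * geodCurv m γ s ^ 3 < 0 := by
        rw [hcube s hs]
        exact mul_neg_of_pos_of_neg (pow_pos (hfpos _ (hmem hs₀ hz₀)) 2) (hodd.pow_neg hneg)
      have h₂ := hodd.pow_neg_iff.1 (neg_of_mul_neg_right h₁ (sq_nonneg _))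
      rw [abs_of_neg h₂]; ring
    · refine ⟨1, by norm_num, fun s hs => ?_⟩
      have h₁ : 0 < f ![s, z₀] ^ 2 * geodCurv m γ s ^ 3 := by
        rw [hcube s hs]
        exact mul_pos (pow_pos (hfpos _ (hmem hs₀ hz₀)) 2) (pow_pos hpos 3)
      have h₂ := hodd.pow_pos_iff.1 (pos_of_mul_pos_right h₁ (sq_nonneg _))
      rw [abs_of_pos h₂]; ring
  -- With |κ| = w⁻² the invariant f²|κ|³ equals (f/w³)², and positivity allows taking the square
  -- root.
  have hsep : ∀ s ∈ I, ∀ z ∈ J, f ![s, z] = f ![s₀, z] / w s₀ ^ 3 * w s ^ 3 := by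
    intro s hs z hz
    have h₁ := sq_mul_geodCurv_cube_eq h hI' hJ hf hfpos hbi hs hs₀ hz
    rw [hσκ s hs, hσκ s₀ hs₀] at h₁
    have h₂ := hwk s hs
    have h₃ := hwk s₀ hs₀
    have p₁ := hwpos s hs
    have p₂ := hwpos s₀ hs₀
    have p₃ := hfpos _ (hmem hs hz)
    have p₄ := hfpos _ (hmem hs₀ hz)
    have hσ3 : σ ^ 3 * σ = 1 := by linear_combination (σ ^ 2 + 1) * hσ
    have hk₁ : |geodCurv m γ s| = (w s ^ 2)⁻¹ := by field_simp; linarith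
    have hk₂ : |geodCurv m γ s₀| = (w s₀ ^ 2)⁻¹ := by field_simp; linarith
    rw [hk₁, hk₂] at h₁
    have h₄ : f ![s, z] ^ 2 * (w s ^ 2)⁻¹ ^ 3 = f ![s₀, z] ^ 2 * (w s₀ ^ 2)⁻¹ ^ 3 := by
      linear_combination σ * h₁ - (f ![s, z] ^ 2 * (w s ^ 2)⁻¹ ^ 3
        - f ![s₀, z] ^ 2 * (w s₀ ^ 2)⁻¹ ^ 3) * hσ3
    have h₅ : (f ![s, z] / w s ^ 3) ^ 2 = (f ![s₀, z] / w s₀ ^ 3) ^ 2 := by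
      field_simp at h₄ ⊢
      linear_combination h₄
    have h₆ := (pow_left_inj₀ (by positivity) (by positivity) two_ne_zero).1 h₅
    rw [← h₆]
    field_simp
  set ψ : ℝ → ℝ := fun z => f ![s₀, z] / w s₀ ^ 3 with hψ
  have hψpos : ∀ z ∈ J, 0 < ψ z := fun z hz =>
    div_pos (hfpos _ (hmem hs₀ hz)) (pow_pos (hwpos s₀ hs₀) 3)
  -- the normal component
  obtain ⟨u, hu⟩ : ∃ u : (Fin 2 → ℝ) → ℝ, u = fun q => f q * geodCurv m γ (q 0) := ⟨_, rfl⟩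
  have hus := contDiffOn_mul_geodCurv h hf
  rw [← hu] at hus
  have hdu : ∀ p ∈ cylinderDomain I J, DifferentiableAt ℝ u p := fun p hp =>
    (hus.contDiffAt (hU.mem_nhds hp)).differentiableAt (by simp)
  have hdpu : ∀ i, ∀ p ∈ cylinderDomain I J, DifferentiableAt ℝ (pd i u) p := fun i p hp =>
    ((contDiffOn_pd hU hus i).contDiffAt (hU.mem_nhds hp)).differentiableAt (by simp)
  have husep : ∀ s ∈ I, ∀ z ∈ J, u ![s, z] = σ * ψ z * w s := by
    intro s hs z hz
    rw [hu]
    simp only [Matrix.cons_val_zero]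
    rw [hsep s hs z hz, hσκ s hs]
    linear_combination ψ z * w s * σ * hwk s hs
  have hσ0 : σ ≠ 0 := by rintro rfl; norm_num at hσ
  -- w and ψ are multiples of slices of the smooth function u = σψw, so their derivatives can be
  -- read off from those of u.
  have hweq : ∀ s ∈ I, w s = u ![s, z₀] / (σ * ψ z₀) := fun s hs => by
    have := (hψpos z₀ hz₀).ne'
    rw [husep s hs z₀ hz₀]; field_simp
  have hψeq : ∀ z ∈ J, ψ z = u ![s₀, z] / (σ * w s₀) := fun z hz => by
    have := (hwpos s₀ hs₀).ne'
    rw [husep s₀ hs₀ z hz]; field_simp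
  set w' : ℝ → ℝ := fun s => pd 0 u ![s, z₀] / (σ * ψ z₀) with hw'
  set ψ' : ℝ → ℝ := fun z => pd 1 u ![s₀, z] / (σ * w s₀) with hψ'
  have hdw : ∀ s ∈ I, HasDerivAt w (w' s) s := fun s hs =>
    ((hasDerivAt_slice_zero (hdu _ (hmem hs hz₀))).div_const _).congr_of_eventuallyEq
      (Filter.eventuallyEq_of_mem (h.isOpen.mem_nhds hs) hweq)
  have hdψ : ∀ z ∈ J, HasDerivAt ψ (ψ' z) z := fun z hz =>
    ((hasDerivAt_slice_one (hdu _ (hmem hs₀ hz))).div_const _).congr_of_eventuallyEq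
      (Filter.eventuallyEq_of_mem (hJ.mem_nhds hz) hψeq)
  set w'' : ℝ → ℝ := fun s => pd 0 (pd 0 u) ![s, z₀] / (σ * ψ z₀)
  set ψ'' : ℝ → ℝ := fun z => pd 1 (pd 1 u) ![s₀, z] / (σ * w s₀)
  have hdw' : ∀ s ∈ I, HasDerivAt w' (w'' s) s := fun s hs =>
    (hasDerivAt_slice_zero (hdpu 0 _ (hmem hs hz₀))).div_const _
  have hdψ' : ∀ z ∈ J, HasDerivAt ψ' (ψ'' z) z := fun z hz =>
    (hasDerivAt_slice_one (hdpu 1 _ (hmem hs₀ hz))).div_const _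
  have hu0 : ∀ s ∈ I, ∀ z ∈ J, pd 0 u ![s, z] = σ * ψ z * w' s := fun s hs z hz =>
    (hasDerivAt_slice_zero (hdu _ (hmem hs hz))).unique
      (((hdw s hs).const_mul (σ * ψ z)).congr_of_eventuallyEq
        (Filter.eventuallyEq_of_mem (h.isOpen.mem_nhds hs) fun t ht => husep t ht z hz))
  have hu1 : ∀ s ∈ I, ∀ z ∈ J, pd 1 u ![s, z] = σ * w s * ψ' z := fun s hs z hz =>
    (hasDerivAt_slice_one (hdu _ (hmem hs hz))).unique
      (((hdψ z hz).const_mul (σ * w s)).congr_of_eventuallyEq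
        (Filter.eventuallyEq_of_mem (hJ.mem_nhds hz) fun t ht =>
          (husep s hs t ht).trans (by ring)))
  have hu00 : ∀ s ∈ I, ∀ z ∈ J, pd 0 (pd 0 u) ![s, z] = σ * ψ z * w'' s := fun s hs z hz =>
    (hasDerivAt_slice_zero (hdpu 0 _ (hmem hs hz))).unique
      (((hdw' s hs).const_mul (σ * ψ z)).congr_of_eventuallyEq
        (Filter.eventuallyEq_of_mem (h.isOpen.mem_nhds hs) fun t ht => hu0 t ht z hz))
  have hu11 : ∀ s ∈ I, ∀ z ∈ J, pd 1 (pd 1 u) ![s, z] = σ * w s * ψ'' z := fun s hs z hz =>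
    (hasDerivAt_slice_one (hdpu 1 _ (hmem hs hz))).unique
      (((hdψ' z hz).const_mul (σ * w s)).congr_of_eventuallyEq
        (Filter.eventuallyEq_of_mem (hJ.mem_nhds hz) fun t ht => hu1 s hs t ht))
  have hpde : ∀ s ∈ I, ∀ z ∈ J,
      ψ z * w'' s + w s * ψ'' z = ((w s ^ 4)⁻¹ - 4 * m) * (ψ z * w s) := by
    intro s hs z hz
    have h₁ := (biharmonic_equations_zero h hJ hf hfpos hbi hu (hmem hs hz)).2
    rw [hu00 s hs z hz, hu11 s hs z hz, husep s hs z hz] at h₁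
    simp only [Matrix.cons_val_zero] at h₁
    have h₂ : geodCurv m γ s ^ 2 = (w s ^ 4)⁻¹ := by
      have := (hwpos s hs).ne'
      have h₃ := hwk s hs
      rw [← sq_abs]
      field_simp
      linear_combination (w s ^ 2 * |geodCurv m γ s| + 1) * h₃
    rw [h₂] at h₁
    apply mul_left_cancel₀ hσ0
    linear_combination h₁
  have hw0 := (hwpos s₀ hs₀).ne'
  have hψ0 := (hψpos z₀ hz₀).ne'
  -- Freezing s = s₀ in the separated equation gives ψ'' = Kψ with this K; freezing z = z₀
  -- afterwards gives the equation for w with the same K.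
  set K : ℝ := (w s₀ ^ 4)⁻¹ - 4 * m - w'' s₀ / w s₀ with hK
  have hψ2 : ∀ z ∈ J, ψ'' z = K * ψ z := by
    intro z hz
    have h₁ := hpde s₀ hs₀ z hz
    apply mul_left_cancel₀ hw0
    have h₂ : w'' s₀ / w s₀ * w s₀ = w'' s₀ := div_mul_cancel₀ _ hw0
    rw [hK]
    linear_combination h₁ + ψ z * h₂
  refine ⟨K, ψ, ψ', w, w', hψpos, hdψ, fun z hz => hψ2 z hz ▸ hdψ' z hz, fun _ => rfl, hdw,
    fun s hs => (hdw' s hs).congr_deriv ?_, hsep⟩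
  have h₁ := hpde s hs z₀ hz₀
  have hws := (hwpos s hs).ne'
  rw [hψ2 z₀ hz₀] at h₁
  apply mul_left_cancel₀ hψ0
  have h₂ : (w s ^ 4)⁻¹ * w s = (w s ^ 3)⁻¹ := by field_simp
  linear_combination h₁ + ψ z₀ * h₂

end Separation

/-- A solution of `ψ'' = K ψ` with `K ≤ 0` which is positive on the whole line is constant. -/
theorem IsFibreSolution.exists_eq_of_pos {K : ℝ} (hK : K ≤ 0) {ψ : ℝ → ℝ}
    (h : IsFibreSolution K Set.univ ψ) (hpos : ∀ z, 0 < ψ z) : ∃ c, ∀ z, ψ z = c := by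
  rcases h with ⟨hK', a, b, h⟩ | ⟨-, a, b, h⟩ | ⟨hK', -⟩
  · exfalso
    have hρ : √(-K) ≠ 0 := (Real.sqrt_pos.2 (neg_pos.2 hK')).ne'
    have h₁ := hpos 0
    -- Half a period after 0 the solution takes the opposite value -b, so it cannot stay positive.
    have h₂ := hpos (Real.pi / √(-K))
    rw [h _ trivial] at h₁ h₂
    rw [mul_div_cancel₀ _ hρ] at h₂
    simp at h₁ h₂
    linarith
  · refine ⟨b, fun z => ?_⟩
    suffices a = 0 by rw [h z trivial, this]; ring
    by_contra ha
    -- At this point the affine function equals -1.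
    have h₁ := hpos (-(b + 1) / a)
    rw [h _ trivial, mul_div_cancel₀ _ ha] at h₁
    linarith
  · exact absurd hK' hK.not_gt

end HopfBCV

end
-- Assembly of the classification.
theorem mainTheorem3 (m l : ℝ) (I J : Set ℝ)
    (hI : IsOpen I) (hI' : I.OrdConnected) (hJ : IsOpen J) (hJ' : J.OrdConnected)
    (γ : ℝ → (Fin 2 → ℝ)) (hγ : ContDiffOn ℝ ∞ γ I)
    (hF : ∀ s ∈ I, HopfBCV.conf m (γ s 0) (γ s 1) ≠ 0)
    (hunit : ∀ s ∈ I, HopfBCV.ip (HopfBCV.baseMetric m) (γ s)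
      (HopfBCV.vel γ s) (HopfBCV.vel γ s) = 1)
    (f : (Fin 2 → ℝ) → ℝ)
    (hf : ContDiffOn ℝ ∞ f (HopfBCV.cylinderDomain I J))
    (hfpos : ∀ p ∈ HopfBCV.cylinderDomain I J, 0 < f p)
    (hfnonconst : ¬ ∃ c : ℝ, ∀ p ∈ HopfBCV.cylinderDomain I J, √(f p) = c)
    (hbi : HopfBCV.IsProperBiharmonicMap (HopfBCV.cylinderDomain I J)
      (fun p => (f p)⁻¹ •
        HopfBCV.pullbackMetric (HopfBCV.bcvMetric m l) (HopfBCV.hopfCylinder γ) p)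
      (HopfBCV.bcvMetric m l) (HopfBCV.hopfCylinder γ)) :
    l = 0 ∧
    (∀ p ∈ HopfBCV.cylinderDomain I J,
      HopfBCV.meanCurvature (HopfBCV.bcvMetric m l) (HopfBCV.hopfCylinder γ)
        (HopfBCV.hopfNormal m l γ) p = HopfBCV.geodCurv m γ (p 0) / 2) ∧
    ((∃ k : ℝ, k ≠ 0 ∧ (∀ s ∈ I, HopfBCV.geodCurv m γ s = k) ∧ 0 < k ^ 2 - 4 * m ∧
        ∃ d₁ d₂ : ℝ, d₁ ^ 2 + d₂ ^ 2 ≠ 0 ∧ ∀ p ∈ HopfBCV.cylinderDomain I J,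
          f p = d₁ * Real.exp (p 1 * √(k ^ 2 - 4 * m))
            + d₂ * Real.exp (-(p 1 * √(k ^ 2 - 4 * m)))) ∨
      ((¬ ∃ k : ℝ, ∀ s ∈ I, HopfBCV.geodCurv m γ s = k) ∧
        (∀ s ∈ I, HopfBCV.geodCurv m γ s ≠ 0) ∧
        ∃ (K : ℝ) (ψ : ℝ → ℝ), (∀ z ∈ J, 0 < ψ z) ∧
          HopfBCV.IsFibreSolution K J ψ ∧
          HopfBCV.IsCurvatureSolution m K I (fun s => |HopfBCV.geodCurv m γ s|) ∧
          ∀ p ∈ HopfBCV.cylinderDomain I J,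
            f p = ψ (p 1) * |HopfBCV.geodCurv m γ (p 0)| ^ (-(3 / 2) : ℝ)) ∨
      (J ≠ Set.univ ∧
        ∃ k : ℝ, k ≠ 0 ∧ (∀ s ∈ I, HopfBCV.geodCurv m γ s = k) ∧ k ^ 2 - 4 * m ≤ 0 ∧
          ∃ ψ : ℝ → ℝ, HopfBCV.IsFibreSolution (k ^ 2 - 4 * m) J ψ ∧
            ∀ p ∈ HopfBCV.cylinderDomain I J, f p = ψ (p 1))) := by

  have h : HopfBCV.IsUnitSpeedCurve m γ I := ⟨hI, hγ, hF, hunit⟩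
  have hl : l = 0 := HopfBCV.eq_zero_of_proper h hI' hJ hJ' hf hfpos hfnonconst hbi
  refine ⟨hl, fun p hp => HopfBCV.meanCurvature_hopfCylinder h l hp.1, ?_⟩
  obtain ⟨s₀, hs₀, z₀, hz₀, hκ₀⟩ := HopfBCV.exists_geodCurv_ne_zero h hJ hf hfpos hbi.2
  subst hl
  have hκ : ∀ s ∈ I, HopfBCV.geodCurv m γ s ≠ 0 := fun s hs =>
    HopfBCV.geodCurv_ne_zero h hI' hJ hf hfpos hbi.1 hs₀ hz₀ hκ₀ hs
  obtain ⟨K, ψ, ψ', w, w', hψpos, hψ, hψ', hwdef, hw, hw', hfw⟩ :=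
    HopfBCV.exists_separation h hI' hJ hf hfpos hbi.1 hs₀ hz₀ hκ
  have hvec : ∀ p : Fin 2 → ℝ, p = ![p 0, p 1] := fun p => by ext i; fin_cases i <;> rfl
  have hwpos : ∀ s ∈ I, 0 < w s := fun s hs => by
    rw [hwdef]; exact inv_pos.2 (Real.sqrt_pos.2 (abs_pos.2 (hκ s hs)))
  by_cases hconst : ∃ k : ℝ, ∀ s ∈ I, HopfBCV.geodCurv m γ s = k
  · obtain ⟨k, hk⟩ := hconst
    have hk0 : k ≠ 0 := hk s₀ hs₀ ▸ hκ₀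
    have hwk : ∀ s ∈ I, w s = (√|k|)⁻¹ := fun s hs => by rw [hwdef, hk s hs]
    obtain ⟨c, hc⟩ : ∃ c, c = (√|k|)⁻¹ := ⟨_, rfl⟩
    rw [← hc] at hwk
    have hcpos : 0 < c := hwk s₀ hs₀ ▸ hwpos s₀ hs₀
    have hc4 : c ^ 4 * k ^ 2 = 1 := by
      have h₁ : c ^ 2 * |k| = 1 := by
        rw [hc, inv_pow, Real.sq_sqrt (abs_nonneg _)]
        exact inv_mul_cancel₀ (abs_pos.2 hk0).ne'
      rw [← sq_abs]
      linear_combination (c ^ 2 * |k| + 1) * h₁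
    -- For constant κ the function w is a constant c, so the Ermakov equation reduces to c⁻³ = (4m +
    -- K)c, where c⁻⁴ = k².
    have hK : K = k ^ 2 - 4 * m := by
      have h₀ : ∀ s ∈ I, w' s = 0 := fun s hs =>
        (hw s hs).unique ((hasDerivAt_const s c).congr_of_eventuallyEq
          (Filter.eventuallyEq_of_mem (hI.mem_nhds hs) hwk))
      have h₁ := (hw' s₀ hs₀).unique ((hasDerivAt_const s₀ (0 : ℝ)).congr_of_eventuallyEq
          (Filter.eventuallyEq_of_mem (hI.mem_nhds hs₀) h₀))
      rw [hwk s₀ hs₀] at h₁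
      field_simp at h₁
      apply mul_left_cancel₀ (pow_pos hcpos 4).ne'
      linear_combination -h₁ - hc4
    have hΨ : ∀ z ∈ J, HasDerivAt (fun z => ψ z * c ^ 3) (ψ' z * c ^ 3) z := fun z hz =>
      (hψ z hz).mul_const _
    have hΨ' : ∀ z ∈ J, HasDerivAt (fun z => ψ' z * c ^ 3) (K * (ψ z * c ^ 3)) z := fun z hz =>
      ((hψ' z hz).mul_const _).congr_deriv (by ring)
    have hfΨ : ∀ p ∈ HopfBCV.cylinderDomain I J, f p = ψ (p 1) * c ^ 3 := fun p hp => by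
      rw [hvec p, hfw _ hp.1 _ hp.2, hwk _ hp.1]; rfl
    have hΨpos : ∀ z ∈ J, 0 < ψ z * c ^ 3 := fun z hz => mul_pos (hψpos z hz) (pow_pos hcpos 3)
    rcases lt_or_ge 0 K with hKpos | hKneg
    · left
      obtain ⟨a, b, hab⟩ := HopfBCV.hyperbolic_solution hJ hJ' hΨ hΨ' ⟨z₀, hz₀⟩ hKpos
      refine ⟨k, hk0, hk, hK ▸ hKpos, a, b, fun h0 => ?_, fun p hp => ?_⟩
      · have ha : a = 0 := by nlinarith [sq_nonneg a, sq_nonneg b]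
        have hb : b = 0 := by nlinarith [sq_nonneg a, sq_nonneg b]
        have h₁ := hΨpos z₀ hz₀
        rw [(hab z₀ hz₀).1, ha, hb] at h₁
        simp at h₁
      · rw [hfΨ p hp, (hab _ hp.2).1, ← hK, mul_comm (√K)]
    · right; right
      have hsol := HopfBCV.isFibreSolution_of_ode hJ hJ' hΨ hΨ' ⟨z₀, hz₀⟩
      refine ⟨?_, k, hk0, hk, hK ▸ hKneg, _, hK ▸ hsol, hfΨ⟩
      -- On a full cylinder the positive fibre solution with K ≤ 0 is constant, so f would be
      -- constant.
      rintro rfl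
      obtain ⟨d, hd⟩ := hsol.exists_eq_of_pos hKneg fun z => hΨpos z trivial
      exact hfnonconst ⟨√d, fun p hp => by rw [hfΨ p hp]; exact congrArg _ (hd (p 1))⟩
  · right; left
    refine ⟨hconst, hκ, K, ψ, hψpos, HopfBCV.isFibreSolution_of_ode hJ hJ' hψ hψ' ⟨z₀, hz₀⟩,
      ?_, fun p hp => ?_⟩
    · have hfun : (fun s => |HopfBCV.geodCurv m γ s|) = fun s => 1 / w s ^ 2 := by
        funext s
        rw [hwdef, inv_pow, Real.sq_sqrt (abs_nonneg _), one_div, inv_inv]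
      rw [hfun]
      exact HopfBCV.isCurvatureSolution_of_ermakov hI hI' ⟨s₀, hs₀⟩ hwpos hw hw'
    · have h₁ : w (p 0) ^ 3 = |HopfBCV.geodCurv m γ (p 0)| ^ (-(3 / 2) : ℝ) := by
        rw [hwdef, Real.rpow_neg (abs_nonneg _), inv_pow, Real.sqrt_eq_rpow,
          ← Real.rpow_natCast, ← Real.rpow_mul (abs_nonneg _)]
        norm_num
      rw [← h₁, ← hfw _ hp.1 _ hp.2, ← hvec]
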